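/- **Theorem.** The Minimum Consistent Subset problem on graphs is fixed-parameter tractable parameterized by neighborhood diversity, admitting an algorithm with running time $O^*(r^{O(r)})$, where $r$ is the neighborhood diversity of the input graph. *Definitions.* Let $G=(V,E)$ be a finite simple graph on $n$ vertices with a coloring $\chi:V\to[c]$, and let $d$ be the shortest-path distance (with $d(u,v)=\infty$ if $u,v$ lie in different components). For $v\in V$ and $U\subseteq V$ let $d(v,U)=\min_{u\in U}d(v,u)$ and $\mathrm{NN}(v,U)=\{u\in U: d(v,u)=d(v,U)\}$. A set $S\subseteq V$ is a *consistent subset* if $\chi(v)\in\chi(\mathrm{NN}(v,S))$ for every $v\in V$. The Minimum Consistent Subset problem asks, given $G$ and $\chi$, to compute a consistent subset of minimum cardinality. Two vertices $u,v$ are *of the same type* if $N(v)\setminus\{u\}=N(u)\setminus\{v\}$; the *neighborhood diversity* of $G$ is the minimum number of classes in a partition of $V$ such that any two vertices in the same class are of the same type. *Precise claim.* There are a deterministic algorithm (a single program of a random access machine with unit-cost addition, truncated subtraction, indirect memory access and zero tests), a computable function $f:\mathbb N\to\mathbb N$ and constants $C,d_0\in\mathbb N$ with $f(r)\le C\,r^{C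 r}$ for all $r$ (where $0^0=1$) such that, for every $n$ and $c$ and every graph $G$ on $n$ vertices with coloring $\chi:V\to[c]$, given by the numbers $n,c$, the list of the colors of the vertices and the adjacency matrix, the algorithm halts after at most $f(r)\cdot(n+1)^{d_0}$ steps and outputs a minimum consistent subset of $(G,\chi)$, where $r$ is the neighborhood diversity of $G$. In particular $f$, $C$ and $d_0$ do not depend on the number $c$ of colors. -/

import Mathlib

/-! ## Random access machine with unit-cost step count -/

/-- Configuration of a random access machine: registers and memory cells, all holding natural
numbers. A program names only finitely many registers; the memory is addressed indirectly. -/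
structure RamState where
  reg : ℕ → ℕ
  mem : ℕ → ℕ

/-- Assign the value `x` to register `d`. -/
def RamState.setReg (s : RamState) (d x : ℕ) : RamState :=
  { s with reg := Function.update s.reg d x }

/-- Write the value `x` to memory cell `i`. -/
def RamState.setMem (s : RamState) (i x : ℕ) : RamState :=
  { s with mem := Function.update s.mem i x }

/-- Deterministic programs of the random access machine. The only arithmetic operations are
addition and truncated subtraction (with multiplication at unit cost the model would be too
strong); branching tests a register for being nonzero. -/
inductive RamProg : Type
  | skip : RamProg
  /-- `reg d := k` -/
  | const (d k : ℕ) : RamProg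
  /-- `reg d := reg a + reg b` -/
  | add (d a b : ℕ) : RamProg
  /-- `reg d := reg a - reg b`, truncated at zero -/
  | sub (d a b : ℕ) : RamProg
  /-- `reg d := mem (reg a)` -/
  | load (d a : ℕ) : RamProg
  /-- `mem (reg a) := reg b` -/
  | store (a b : ℕ) : RamProg
  | seq (p q : RamProg) : RamProg
  /-- if `reg a ≠ 0` then `p` else `q` -/
  | ite (a : ℕ) (p q : RamProg) : RamProg
  /-- while `reg a ≠ 0` do `p` -/
  | loop (a : ℕ) (p : RamProg) : RamProg

/-- `RamExec p s s' t`: started in `s`, the program `p` halts in `s'` after exactly `t` steps.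
Every elementary operation and every test costs one step. -/
inductive RamExec : RamProg → RamState → RamState → ℕ → Prop
  | skip (s : RamState) : RamExec .skip s s 1
  | const (s : RamState) (d k : ℕ) : RamExec (.const d k) s (s.setReg d k) 1
  | add (s : RamState) (d a b : ℕ) :
      RamExec (.add d a b) s (s.setReg d (s.reg a + s.reg b)) 1
  | sub (s : RamState) (d a b : ℕ) :
      RamExec (.sub d a b) s (s.setReg d (s.reg a - s.reg b)) 1
  | load (s : RamState) (d a : ℕ) :
      RamExec (.load d a) s (s.setReg d (s.mem (s.reg a))) 1
  | store (s : RamState) (a b : ℕ) :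
      RamExec (.store a b) s (s.setMem (s.reg a) (s.reg b)) 1
  | seq {p q : RamProg} {s s' s'' : RamState} {t t' : ℕ}
      (hp : RamExec p s s' t) (hq : RamExec q s' s'' t') :
      RamExec (.seq p q) s s'' (t + t')
  | ite_true {p q : RamProg} {a : ℕ} {s s' : RamState} {t : ℕ}
      (ha : s.reg a ≠ 0) (hp : RamExec p s s' t) : RamExec (.ite a p q) s s' (t + 1)
  | ite_false {p q : RamProg} {a : ℕ} {s s' : RamState} {t : ℕ}
      (ha : s.reg a = 0) (hq : RamExec q s s' t) : RamExec (.ite a p q) s s' (t + 1)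
  | loop_done {p : RamProg} {a : ℕ} {s : RamState}
      (ha : s.reg a = 0) : RamExec (.loop a p) s s 1
  | loop_step {p : RamProg} {a : ℕ} {s s' s'' : RamState} {t t' : ℕ}
      (ha : s.reg a ≠ 0) (hp : RamExec p s s' t) (hl : RamExec (.loop a p) s' s'' t') :
      RamExec (.loop a p) s s'' (t + t' + 1)

/-- The initial configuration on an input list of numbers: cell `i` of the memory holds the
`i`-th entry, all other cells and all registers hold `0`. -/
def RamState.init (input : List ℕ) : RamState where
  reg := fun _ => 0
  mem := fun i => input.getD i 0

/-! ## Consistent subsets -/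

section Graphs

variable {V : Type*} (G : SimpleGraph V)

/-- The distance `d(v, U) = min_{u ∈ U} d(v, u)` in the shortest path metric; distances between
different components are `⊤`, and so is the distance to the empty set. -/
noncomputable def distToSet (v : V) (U : Set V) : ℕ∞ :=
  ⨅ u ∈ U, G.edist v u

/-- The set `NN(v, U)` of nearest neighbors of `v` in `U`. -/
def nearestNeighbors (v : V) (U : Set V) : Set V :=
  {u ∈ U | G.edist v u = distToSet G v U}

/-- `S` is a consistent subset: the color of each vertex `v` is present among the colors of the
nearest neighbors of `v` in `S`. -/
def IsConsistentSubset {κ : Type*} (color : V → κ) (S : Set V) : Prop :=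
  ∀ v : V, color v ∈ color '' nearestNeighbors G v S

/-- `S` is a consistent subset of minimum cardinality. -/
def IsMinConsistentSubset {κ : Type*} (color : V → κ) (S : Finset V) : Prop :=
  IsConsistentSubset G color (S : Set V) ∧
    ∀ S' : Finset V, IsConsistentSubset G color (S' : Set V) → S.card ≤ S'.card

/-! ## Neighborhood diversity -/

/-- Two vertices are of the same type if `N(v) \ {u} = N(u) \ {v}`. -/
def SameType (u v : V) : Prop :=
  G.neighborSet v \ {u} = G.neighborSet u \ {v}

/-- A neighborhood decomposition: a partition of the vertices such that all vertices in a class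
are of the same type. -/
def IsNeighborhoodDecomposition [Fintype V] [DecidableEq V]
    (P : Finpartition (Finset.univ : Finset V)) : Prop :=
  ∀ C ∈ P.parts, ∀ u ∈ C, ∀ v ∈ C, SameType G u v

/-- The neighborhood diversity: the minimum size of a neighborhood decomposition. -/
noncomputable def neighborhoodDiversity [Fintype V] [DecidableEq V] : ℕ :=
  sInf {w : ℕ | ∃ P : Finpartition (Finset.univ : Finset V),
    IsNeighborhoodDecomposition G P ∧ P.parts.card = w}

end Graphs

/-! ## The computational problem -/

open Classical in
/-- Encoding of a graph on `Fin n` colored with `Fin c`: the numbers `n` and `c`, then the `n`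
colors, then the `n × n` adjacency matrix row by row. -/
noncomputable def encodeColoredGraph {n c : ℕ} (G : SimpleGraph (Fin n)) (color : Fin n → Fin c) :
    List ℕ :=
  [n, c] ++ (List.finRange n).map (fun v => (color v : ℕ)) ++
    (List.finRange n).flatMap (fun u =>
      (List.finRange n).map (fun v => if G.Adj u v then 1 else 0))

/-- The program `p` solves the Minimum Consistent Subset problem within `T G` steps on each
colored graph with underlying graph `G`: it halts with the indicator vector of a minimum
consistent subset in the first `n` memory cells. -/
def SolvesMCSInTime (p : RamProg) (T : ∀ {n : ℕ}, SimpleGraph (Fin n) → ℕ) : Prop :=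
  ∀ (n c : ℕ) (G : SimpleGraph (Fin n)) (color : Fin n → Fin c),
    ∃ (s : RamState) (t : ℕ),
      RamExec p (RamState.init (encodeColoredGraph G color)) s t ∧ t ≤ T G ∧
      ∃ S : Finset (Fin n), IsMinConsistentSubset G color S ∧
        ∀ v : Fin n, s.mem v = if v ∈ S then 1 else 0

/-! Exchanging two vertices of the same type is an automorphism, so such vertices have equal
distances to every third vertex (`edist_eq_of_sameType`). Hence whether a vertex outside `S` finds
its color among its nearest neighbors in `S` depends only on its type, the types met by `S`, and the
types met by the part of `S` in its color class. This allows a dynamic program that decides the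
vertices one by one, sorted by color. The condition also refers to vertices of `S` decided later, so
the types of the final solution are guessed beforehand, as the types of an auxiliary set `R`.

A partial solution `(R, S)` is summarized by its `signature`: the types of `R`, of `S`, of the
chosen and of the rejected vertices in the color class under treatment, one bit telling whether all
completed classes are served, and the size of `S`. At most one class is incomplete at any time, so
there are at most `2 ^ (4 * r + 1) * (n + 1)` signatures, whatever the number of colors
(`card_le_of_injOn_signature`). Partial solutions with equal signatures keep equal signatures under
the same decision (`signature_insert_left`, `signature_union_right`; the crucial case, a class being
completed, rests on `served_of_image_eq`). At the end, a pair with the signature of `(U, U)` for a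
consistent `U` contains a consistent set of the same size (`exists_near_of_signature_eq`). It
therefore suffices to keep representatives of all signatures; each of the `2 * n` rounds adds at
most one row per signature.

On the machine, `Realizes` packages correctness with a time bound polynomial in a common bound `L`
on all loop lengths. Here `L` is `2 ^ (O(r))` times a polynomial in `n`, which gives time `2 ^
(O(r)) * n ^ (O(1))` and in particular the claimed bound. -/

/-! ## Combinators for programs of the random access machine -/

/-- A context of read-only local variables, kept in the registers below `size`. -/
class RegContext (Γ : Type) where
  size : ℕ
  read : Γ → ℕ → ℕ

instance : RegContext Unit := ⟨0, fun _ _ => 0⟩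

instance (Γ : Type) [RegContext Γ] : RegContext (Γ × ℕ) :=
  ⟨RegContext.size Γ + 1, fun γ i =>
    if i < RegContext.size Γ then RegContext.read γ.1 i else γ.2⟩

open RegContext

theorem RegContext.size_prod (Γ : Type) [RegContext Γ] : size (Γ × ℕ) = size Γ + 1 := rfl

theorem RegContext.read_prod {Γ : Type} [RegContext Γ] (γ : Γ × ℕ) (i : ℕ) :
    read γ i = if i < size Γ then read γ.1 i else γ.2 := rfl

/-- Functions with a polynomial bound. -/
def PolyBounded (T : ℕ → ℕ) : Prop := ∃ c e : ℕ, ∀ L, T L ≤ c * (L + 1) ^ e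

namespace PolyBounded

theorem const (k : ℕ) : PolyBounded fun _ => k := ⟨k, 0, by simp⟩

theorem id : PolyBounded fun L => L := ⟨1, 1, by intro L; simp⟩

theorem add {T U : ℕ → ℕ} (hT : PolyBounded T) (hU : PolyBounded U) :
    PolyBounded fun L => T L + U L := by
  obtain ⟨c, e, h⟩ := hT
  obtain ⟨c', e', h'⟩ := hU
  refine ⟨c + c', e + e', fun L => ?_⟩
  have h1 : (L + 1) ^ e ≤ (L + 1) ^ (e + e') := Nat.pow_le_pow_right (by omega) (by omega)
  have h2 : (L + 1) ^ e' ≤ (L + 1) ^ (e + e') := Nat.pow_le_pow_right (by omega) (by omega)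
  have := h L
  have := h' L
  have h3 := Nat.mul_le_mul_left c h1
  have h4 := Nat.mul_le_mul_left c' h2
  simp only [add_mul]
  omega

theorem mul {T U : ℕ → ℕ} (hT : PolyBounded T) (hU : PolyBounded U) :
    PolyBounded fun L => T L * U L := by
  obtain ⟨c, e, h⟩ := hT
  obtain ⟨c', e', h'⟩ := hU
  refine ⟨c * c', e + e', fun L => ?_⟩
  calc T L * U L ≤ (c * (L + 1) ^ e) * (c' * (L + 1) ^ e') := Nat.mul_le_mul (h L) (h' L)
    _ = c * c' * (L + 1) ^ (e + e') := by ring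

end PolyBounded

/-- `m ↦ F (… (F (F m 0) 1) …) (N - 1)`. -/
def foldUpTo {α : Type*} (F : α → ℕ → α) (m : α) : ℕ → α
  | 0 => m
  | N + 1 => F (foldUpTo F m N) N

namespace RamState

theorem setReg_reg (s : RamState) (d x r : ℕ) :
    (s.setReg d x).reg r = if r = d then x else s.reg r := by
  simp [setReg, Function.update_apply]

@[simp] theorem setReg_mem (s : RamState) (d x : ℕ) : (s.setReg d x).mem = s.mem := rfl

@[simp] theorem setMem_reg (s : RamState) (d x : ℕ) : (s.setMem d x).reg = s.reg := rfl

@[simp] theorem setMem_mem (s : RamState) (d x : ℕ) :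
    (s.setMem d x).mem = Function.update s.mem d x := rfl

end RamState

open RamState

/-! ### Basic constructions: expressions, sequencing, branching, local variables, loops. -/

section Realizes

variable {Γ : Type} [RegContext Γ]

/-- There is a program that transforms the memory by `F` and computes the value of `f`, in a time
that is polynomial in each `L` for which the precondition `V` holds. -/
def Realizes (V : (ℕ → ℕ) → Γ → ℕ → Prop) (F : (ℕ → ℕ) → Γ → ℕ → ℕ) (f : (ℕ → ℕ) → Γ → ℕ) :
    Prop :=
  ∃ (p : ℕ → RamProg) (T : ℕ → ℕ), PolyBounded T ∧
    -- Registers from `d` on are scratch space, those below `d` survive, and the value is left in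
    -- register `d`; programs nest by raising `d`. The bound `T` belongs to the program alone, while
    -- `L` comes from the precondition.
    ∀ d, size Γ ≤ d → ∀ s γ L, V s.mem γ L → (∀ i < size Γ, s.reg i = read γ i) →
      ∃ s' t, RamExec (p d) s s' t ∧ t ≤ T L ∧ s'.mem = F s.mem γ ∧
        (∀ i < d, s'.reg i = s.reg i) ∧ s'.reg d = f s.mem γ

/-- There is a polynomial time program for the expression `f`. -/
def RealizesExpr (V : (ℕ → ℕ) → Γ → ℕ → Prop) (f : (ℕ → ℕ) → Γ → ℕ) : Prop :=
  Realizes V (fun m _ => m) f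

/-- There is a polynomial time program for the memory transformation `F`. -/
def RealizesMem (V : (ℕ → ℕ) → Γ → ℕ → Prop) (F : (ℕ → ℕ) → Γ → ℕ → ℕ) : Prop :=
  Realizes V F (fun _ _ => 0)

variable {V : (ℕ → ℕ) → Γ → ℕ → Prop}

theorem Realizes.mono {W : (ℕ → ℕ) → Γ → ℕ → Prop} {F f} (h : Realizes V F f)
    (hW : ∀ m γ L, W m γ L → V m γ L) : Realizes W F f := by
  obtain ⟨p, T, hT, h⟩ := h
  exact ⟨p, T, hT, fun d hd s γ L hV => h d hd s γ L (hW _ _ _ hV)⟩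

theorem Realizes.congr {F G : (ℕ → ℕ) → Γ → ℕ → ℕ} {f g : (ℕ → ℕ) → Γ → ℕ} (h : Realizes V F f)
    (hF : ∀ m γ L, V m γ L → F m γ = G m γ) (hf : ∀ m γ L, V m γ L → f m γ = g m γ) :
    Realizes V G g := by
  obtain ⟨p, T, hT, h⟩ := h
  refine ⟨p, T, hT, fun d hd s γ L hV hr => ?_⟩
  rw [← hF _ _ _ hV, ← hf _ _ _ hV]
  exact h d hd s γ L hV hr

theorem RealizesExpr.const (k : ℕ) : RealizesExpr V fun _ _ => k := by
  refine ⟨fun d => .const d k, _, PolyBounded.const 1, fun d hd s γ L hV hr => ?_⟩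
  refine ⟨_, _, .const .., le_rfl, rfl, fun i hi => ?_, ?_⟩
  · rw [setReg_reg, if_neg (by omega)]
  · simp [setReg_reg]

theorem RealizesExpr.snd {V : (ℕ → ℕ) → Γ × ℕ → ℕ → Prop} : RealizesExpr V fun _ p => p.2 := by
  -- The machine has no copy instruction; adding to a zeroed register copies. The registers `d` and
  -- `size Γ` differ because the context here has size `size Γ + 1`.
  refine ⟨fun d => .seq (.const d 0) (.add d d (size Γ)), _, PolyBounded.const 2,
    fun d hd s γ L hV hr => ?_⟩
  rw [size_prod] at hd hr
  refine ⟨_, _, .seq (.const ..) (.add ..), le_rfl, rfl, fun i hi => ?_, ?_⟩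
  · rw [setReg_reg, if_neg (by omega), setReg_reg, if_neg (by omega)]
  · have := hr (size Γ) (by omega)
    rw [read_prod, if_neg (by omega)] at this
    simp only [setReg_reg, if_true]
    rw [if_neg (by omega), this, zero_add]

theorem Realizes.weaken {F f} (h : Realizes V F f) :
    Realizes (Γ := Γ × ℕ) (fun m p L => V m p.1 L) (fun m p => F m p.1) (fun m p => f m p.1) := by
  obtain ⟨p, T, hT, h⟩ := h
  refine ⟨p, T, hT, fun d hd s γ L hV hr => ?_⟩
  rw [size_prod] at hd hr
  refine h d (by omega) s γ.1 L hV fun i hi => ?_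
  have := hr i (by omega)
  rwa [read_prod, if_pos hi] at this

theorem RealizesExpr.fst {V : (ℕ → ℕ) → Γ × ℕ → ℕ → Prop} {f : (ℕ → ℕ) → Γ → ℕ}
    (h : RealizesExpr (fun _ _ _ => True) f) : RealizesExpr V fun m p => f m p.1 :=
  (Realizes.weaken h).mono fun _ _ _ _ => trivial

theorem RealizesExpr.load {a : (ℕ → ℕ) → Γ → ℕ} (h : RealizesExpr V a) :
    RealizesExpr V fun m γ => m (a m γ) := by
  obtain ⟨p, T, hT, h⟩ := h
  refine ⟨fun d => .seq (p d) (.load d d), _, hT.add (.const 1), fun d hd s γ L hV hr => ?_⟩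
  obtain ⟨s', t, he, ht, hm, hreg, hval⟩ := h d hd s γ L hV hr
  refine ⟨_, _, .seq he (.load ..), by omega, hm, fun i hi => ?_, ?_⟩
  · rw [setReg_reg, if_neg (by omega), hreg i hi]
  · simp [setReg_reg, hval, hm]

/-- Evaluation of two expressions in succession. -/
theorem RealizesExpr.pair {a b : (ℕ → ℕ) → Γ → ℕ} (ha : RealizesExpr V a)
    (hb : RealizesExpr V b) :
    ∃ (p : ℕ → RamProg) (T : ℕ → ℕ), PolyBounded T ∧
    ∀ d, size Γ ≤ d → ∀ s γ L, V s.mem γ L → (∀ i < size Γ, s.reg i = read γ i) →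
      ∃ s' t, RamExec (p d) s s' t ∧ t ≤ T L ∧ s'.mem = s.mem ∧
        (∀ i < d, s'.reg i = s.reg i) ∧ s'.reg d = a s.mem γ ∧ s'.reg (d + 1) = b s.mem γ := by
  obtain ⟨p, T, hT, h⟩ := ha
  obtain ⟨q, U, hU, h'⟩ := hb
  refine ⟨fun d => .seq (p d) (q (d + 1)), _, hT.add hU, fun d hd s γ L hV hr => ?_⟩
  obtain ⟨s1, t1, he, ht, hm, hreg, hval⟩ := h d hd s γ L hV hr
  obtain ⟨s2, t2, he', ht', hm', hreg', hval'⟩ := h' (d + 1) (by omega) s1 γ L (by rwa [hm])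
    (fun i hi => by rw [hreg i (by omega), hr i hi])
  refine ⟨s2, _, .seq he he', by omega, hm'.trans hm, fun i hi => ?_, ?_, ?_⟩
  · rw [hreg' i (by omega), hreg i hi]
  · rw [hreg' d (by omega), hval]
  · rw [hval', hm]

theorem RealizesExpr.add {a b : (ℕ → ℕ) → Γ → ℕ} (ha : RealizesExpr V a)
    (hb : RealizesExpr V b) : RealizesExpr V fun m γ => a m γ + b m γ := by
  obtain ⟨p, T, hT, h⟩ := ha.pair hb
  refine ⟨fun d => .seq (p d) (.add d d (d + 1)), _, hT.add (.const 1),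
    fun d hd s γ L hV hr => ?_⟩
  obtain ⟨s', t, he, ht, hm, hreg, hval, hval'⟩ := h d hd s γ L hV hr
  refine ⟨_, _, .seq he (.add ..), by omega, hm, fun i hi => ?_, ?_⟩
  · rw [setReg_reg, if_neg (by omega), hreg i hi]
  · simp [setReg_reg, hval, hval']

theorem RealizesExpr.sub {a b : (ℕ → ℕ) → Γ → ℕ} (ha : RealizesExpr V a)
    (hb : RealizesExpr V b) : RealizesExpr V fun m γ => a m γ - b m γ := by
  obtain ⟨p, T, hT, h⟩ := ha.pair hb
  refine ⟨fun d => .seq (p d) (.sub d d (d + 1)), _, hT.add (.const 1),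
    fun d hd s γ L hV hr => ?_⟩
  obtain ⟨s', t, he, ht, hm, hreg, hval, hval'⟩ := h d hd s γ L hV hr
  refine ⟨_, _, .seq he (.sub ..), by omega, hm, fun i hi => ?_, ?_⟩
  · rw [setReg_reg, if_neg (by omega), hreg i hi]
  · simp [setReg_reg, hval, hval']

theorem RealizesMem.store {a b : (ℕ → ℕ) → Γ → ℕ} (ha : RealizesExpr V a)
    (hb : RealizesExpr V b) :
    RealizesMem V fun m γ => Function.update m (a m γ) (b m γ) := by
  obtain ⟨p, T, hT, h⟩ := ha.pair hb
  refine ⟨fun d => .seq (p d) (.seq (.store d (d + 1)) (.const d 0)), _, hT.add (.const 2),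
    fun d hd s γ L hV hr => ?_⟩
  obtain ⟨s', t, he, ht, hm, hreg, hval, hval'⟩ := h d hd s γ L hV hr
  refine ⟨_, _, .seq he (.seq (.store ..) (.const ..)), by omega, ?_, fun i hi => ?_, ?_⟩
  · simp [hval, hval', hm]
  · rw [setReg_reg, if_neg (by omega), setMem_reg, hreg i hi]
  · simp [setReg_reg]

theorem RealizesMem.skip : RealizesMem V fun m _ => m := RealizesExpr.const 0

theorem RealizesMem.seq {F G : (ℕ → ℕ) → Γ → ℕ → ℕ} {W : (ℕ → ℕ) → Γ → ℕ → Prop}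
    (hF : RealizesMem V F) (hG : RealizesMem W G) (hW : ∀ m γ L, V m γ L → W (F m γ) γ L) :
    RealizesMem V fun m γ => G (F m γ) γ := by
  obtain ⟨p, T, hT, h⟩ := hF
  obtain ⟨q, U, hU, h'⟩ := hG
  refine ⟨fun d => .seq (p d) (q d), _, hT.add hU, fun d hd s γ L hV hr => ?_⟩
  obtain ⟨s1, t1, he, ht, hm, hreg, hval⟩ := h d hd s γ L hV hr
  obtain ⟨s2, t2, he', ht', hm', hreg', hval'⟩ := h' d (by omega) s1 γ L
    (by rw [hm]; exact hW _ _ _ hV) (fun i hi => by rw [hreg i (by omega), hr i hi])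
  refine ⟨s2, _, .seq he he', by omega, by rw [hm', hm], fun i hi => ?_, hval'⟩
  rw [hreg' i (by omega), hreg i hi]

theorem Realizes.ite {c : (ℕ → ℕ) → Γ → ℕ} {F G : (ℕ → ℕ) → Γ → ℕ → ℕ}
    {f g : (ℕ → ℕ) → Γ → ℕ} (hc : RealizesExpr V c) (hF : Realizes V F f) (hG : Realizes V G g) :
    Realizes V (fun m γ => if c m γ ≠ 0 then F m γ else G m γ)
      (fun m γ => if c m γ ≠ 0 then f m γ else g m γ) := by
  obtain ⟨p, T, hT, h⟩ := hc
  obtain ⟨q, U, hU, h'⟩ := hF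
  obtain ⟨q', U', hU', h''⟩ := hG
  refine ⟨fun d => .seq (p d) (.ite d (q d) (q' d)), _, (hT.add (hU.add hU')).add (.const 1),
    fun d hd s γ L hV hr => ?_⟩
  obtain ⟨s1, t1, he, ht, hm, hreg, hval⟩ := h d hd s γ L hV hr
  have hr1 : ∀ i < size Γ, s1.reg i = read γ i := fun i hi => by rw [hreg i (by omega), hr i hi]
  have hV1 : V s1.mem γ L := by rwa [hm]
  by_cases h0 : c s.mem γ ≠ 0
  · obtain ⟨s2, t2, he', ht', hm', hreg', hval'⟩ := h' d hd s1 γ L hV1 hr1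
    refine ⟨s2, _, .seq he (.ite_true (by rwa [hval]) he'), by omega, ?_, fun i hi => ?_, ?_⟩
    · simp only [if_pos h0, hm', hm]
    · rw [hreg' i (by omega), hreg i hi]
    · simp only [if_pos h0, hval', hm]
  · obtain ⟨s2, t2, he', ht', hm', hreg', hval'⟩ := h'' d hd s1 γ L hV1 hr1
    refine ⟨s2, _, .seq he (.ite_false (by rw [hval]; simpa using h0) he'), by omega, ?_,
      fun i hi => ?_, ?_⟩
    · simp only [if_neg h0, hm', hm]
    · rw [hreg' i (by omega), hreg i hi]
    · simp only [if_neg h0, hval', hm]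

/-- A local variable. -/
theorem RealizesMem.bind {f : (ℕ → ℕ) → Γ → ℕ} {G : (ℕ → ℕ) → Γ × ℕ → ℕ → ℕ}
    {W : (ℕ → ℕ) → Γ × ℕ → ℕ → Prop} (hf : RealizesExpr V f) (hG : RealizesMem W G)
    (hW : ∀ m γ L, V m γ L → W m (γ, f m γ) L) :
    RealizesMem V fun m γ => G m (γ, f m γ) := by
  obtain ⟨p, T, hT, h⟩ := hf
  obtain ⟨q, U, hU, h'⟩ := hG
  -- The new variable has to live in register `size Γ`, which may lie below `d` and hold a value of
  -- the caller. That value is saved in `d + 2` and restored at the end; `d + 3` supplies the zero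
  -- for copying.
  refine ⟨fun d => .seq (p (d + 1)) <| .seq (.const (d + 3) 0) <|
      .seq (.add (d + 2) (size Γ) (d + 3)) <| .seq (.add (size Γ) (d + 1) (d + 3)) <|
      .seq (q (d + 3)) <| .seq (.const (d + 3) 0) <| .seq (.add (size Γ) (d + 2) (d + 3)) <|
      .const d 0, _, (hT.add hU).add (.const 6), fun d hd s γ L hV hr => ?_⟩
  obtain ⟨s1, t1, he, ht, hm, hreg, hval⟩ := h (d + 1) (by omega) s γ L hV hr
  let s2 := ((s1.setReg (d + 3) 0).setReg (d + 2) (s1.reg (size Γ))).setReg (size Γ)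
    (f s.mem γ)
  obtain ⟨s3, t3, he', ht', hm', hreg', hval'⟩ := h' (d + 3) (by rw [size_prod]; omega) s2
    (γ, f s.mem γ) L (by simpa [s2, hm] using hW _ _ _ hV) (fun i hi => by
      rw [size_prod] at hi
      rw [read_prod]
      split_ifs with hi'
      · simp only [s2, setReg_reg]
        rw [if_neg (by omega), if_neg (by omega), if_neg (by omega), hreg i (by omega), hr i hi']
      · have : i = size Γ := by omega
        simp [s2, setReg_reg, this])
  have hs2 : s2 = ((s1.setReg (d + 3) 0).setReg (d + 2) ((s1.setReg (d + 3) 0).reg (size Γ) +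
      (s1.setReg (d + 3) 0).reg (d + 3))).setReg (size Γ)
      (((s1.setReg (d + 3) 0).setReg (d + 2) ((s1.setReg (d + 3) 0).reg (size Γ) +
      (s1.setReg (d + 3) 0).reg (d + 3))).reg (d + 1) +
      ((s1.setReg (d + 3) 0).setReg (d + 2) ((s1.setReg (d + 3) 0).reg (size Γ) +
      (s1.setReg (d + 3) 0).reg (d + 3))).reg (d + 3)) := by
    have : size Γ ≠ d + 3 := by omega
    simp [s2, setReg_reg, hval, this]
  refine ⟨_, _, .seq he <| .seq (.const ..) <| .seq (.add ..) <| .seq (.add ..) <|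
    .seq (hs2 ▸ he') <| .seq (.const ..) <| .seq (.add ..) (.const ..), by omega, ?_,
    fun i hi => ?_, ?_⟩
  · simp [hm', s2, hm]
  · have h1 := hreg' i (by omega)
    have h2 := hreg' (d + 2) (by omega)
    have h3 := hreg i (by omega)
    have h4 := hreg (size Γ) (by omega)
    simp only [setReg_reg, s2] at h1 h2 ⊢
    split_ifs at * <;> grind
  · simp [setReg_reg]

/-- A loop over the numbers below `N`, which accumulates the values of the body. -/
theorem Realizes.loop {N : (ℕ → ℕ) → Γ → ℕ} {F : (ℕ → ℕ) → Γ × ℕ → ℕ → ℕ}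
    {f : (ℕ → ℕ) → Γ × ℕ → ℕ} {W : (ℕ → ℕ) → Γ × ℕ → ℕ → Prop} (hN : RealizesExpr V N)
    (hF : Realizes W F f) (hL : ∀ m γ L, V m γ L → N m γ ≤ L)
    (hW : ∀ m γ L, V m γ L → ∀ i < N m γ, W (foldUpTo (fun m i => F m (γ, i)) m i) (γ, i) L) :
    Realizes V (fun m γ => foldUpTo (fun m i => F m (γ, i)) m (N m γ))
      (fun m γ => ∑ i ∈ Finset.range (N m γ), f (foldUpTo (fun m i => F m (γ, i)) m i) (γ, i)) := by
  obtain ⟨p, T, hT, h⟩ := hN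
  obtain ⟨q, U, hU, h'⟩ := hF
  -- Register `d + 1` counts the remaining iterations, `size Γ` holds the index (its old content is
  -- saved in `d + 2`), `d + 3` accumulates the sum, and the body leaves its value in `d + 4`.
  refine ⟨fun d => .seq (p (d + 1)) <| .seq (.const (d + 3) 0) <|
      .seq (.add (d + 2) (size Γ) (d + 3)) <| .seq (.const (size Γ) 0) <|
      .seq (.loop (d + 1) (.seq (q (d + 4)) <| .seq (.add (d + 3) (d + 3) (d + 4)) <|
        .seq (.const (d + 4) 1) <| .seq (.add (size Γ) (size Γ) (d + 4)) <|
        .sub (d + 1) (d + 1) (d + 4))) <|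
      .seq (.const (d + 4) 0) <| .seq (.add (size Γ) (d + 2) (d + 4)) <|
      .add d (d + 3) (d + 4), _,
      (hT.add (.add (.mul .id (hU.add (.const 5))) (.const 1))).add (.const 6),
      fun d hd s γ L hV hr => ?_⟩
  obtain ⟨s1, t1, he, ht, hm, hreg, hval⟩ := h (d + 1) (by omega) s γ L hV hr
  -- Induction on the number `k` of remaining iterations, for all states that agree with the first
  -- `i` iterations.
  have key : ∀ k i, i + k = N s.mem γ → ∀ s' : RamState,
      s'.mem = foldUpTo (fun m i => F m (γ, i)) s.mem i → s'.reg (d + 1) = k →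
      s'.reg (size Γ) = i → s'.reg (d + 2) = s1.reg (size Γ) →
      s'.reg (d + 3) = ∑ i ∈ Finset.range i, f (foldUpTo (fun m i => F m (γ, i)) s.mem i) (γ, i) →
      (∀ j < d, j ≠ size Γ → s'.reg j = s1.reg j) →
      ∃ s'' t, RamExec (.loop (d + 1) (.seq (q (d + 4)) <| .seq (.add (d + 3) (d + 3) (d + 4)) <|
        .seq (.const (d + 4) 1) <| .seq (.add (size Γ) (size Γ) (d + 4)) <|
        .sub (d + 1) (d + 1) (d + 4))) s' s'' t ∧ t ≤ k * (U L + 5) + 1 ∧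
      s''.mem = foldUpTo (fun m i => F m (γ, i)) s.mem (N s.mem γ) ∧
      s''.reg (d + 2) = s1.reg (size Γ) ∧
      s''.reg (d + 3) = ∑ i ∈ Finset.range (N s.mem γ),
        f (foldUpTo (fun m i => F m (γ, i)) s.mem i) (γ, i) ∧
      (∀ j < d, j ≠ size Γ → s''.reg j = s1.reg j) := by
    intro k
    induction k with
    | zero =>
      intro i hi s' hm' hk hc hs ha hj
      have hi : i = N s.mem γ := by omega
      subst hi
      exact ⟨s', _, .loop_done hk, by omega, hm', hs, ha, hj⟩
    | succ k ih =>
      intro i hi s' hm' hk hc hs ha hj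
      obtain ⟨s2, t2, he2, ht2, hm2, hreg2, hval2⟩ := h' (d + 4) (by rw [size_prod]; omega) s'
        (γ, i) L (by rw [hm']; exact hW _ _ _ hV i (by omega)) (fun j hj' => by
          rw [size_prod] at hj'
          rw [read_prod]
          split_ifs with hlt
          · rw [hj j (by omega) (by omega), hreg j (by omega), hr j hlt]
          · have : j = size Γ := by omega
            rw [this, hc])
      let s3 := (((s2.setReg (d + 3) (s2.reg (d + 3) + s2.reg (d + 4))).setReg (d + 4) 1).setReg
        (size Γ) (i + 1)).setReg (d + 1) k
      have e1 := hreg2 (size Γ) (by omega)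
      have e2 := hreg2 (d + 1) (by omega)
      have e3 := hreg2 (d + 2) (by omega)
      have e4 := hreg2 (d + 3) (by omega)
      obtain ⟨s4, t4, he4, ht4, r1, r2, r3, r4⟩ := ih (i + 1) (by omega) s3
        (by simp [s3, hm2, foldUpTo, hm']) (by simp [s3, setReg_reg])
        (by have : size Γ ≠ d + 1 := by omega
            simp [s3, setReg_reg, this])
        (by have : d + 2 ≠ size Γ := by omega
            simp [s3, setReg_reg, this, e3, hs])
        (by have : d + 3 ≠ size Γ := by omega
            simp [s3, setReg_reg, this, e4, ha, hval2, Finset.sum_range_succ, hm'])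
        (fun j hj1 hj2 => by
          have a1 : j ≠ d + 1 := by omega
          have a2 : j ≠ d + 4 := by omega
          have a3 : j ≠ d + 3 := by omega
          simp [s3, setReg_reg, a1, a2, a3, hj2, hreg2 j (by omega), hj j hj1 hj2])
      refine ⟨s4, _, .loop_step (t' := t4) (by omega) (.seq he2 <| .seq (.add ..) <| .seq (.const ..) <|
        .seq (.add ..) (.sub ..)) ?_, ?_, r1, r2, r3, r4⟩
      · convert he4 using 1
        have a1 : size Γ ≠ d + 4 := by omega
        have a2 : size Γ ≠ d + 3 := by omega
        have a3 : d + 1 ≠ size Γ := by omega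
        have a4 : d + 4 ≠ size Γ := by omega
        simp [s3, setReg_reg, a1, a2, a3, a4, e1, e2, hc, hk]
      · rw [add_mul]
        omega
  have b1 : size Γ ≠ d + 3 := by omega
  have b2 : d + 1 ≠ size Γ := by omega
  have b3 : d + 2 ≠ size Γ := by omega
  have b4 : d + 3 ≠ size Γ := by omega
  obtain ⟨s5, t5, he5, ht5, r1, r2, r3, r4⟩ := key (N s.mem γ) 0 (by omega)
    (((s1.setReg (d + 3) 0).setReg (d + 2) ((s1.setReg (d + 3) 0).reg (size Γ) +
      (s1.setReg (d + 3) 0).reg (d + 3))).setReg (size Γ) 0)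
    (by simp [hm, foldUpTo]) (by simp [setReg_reg, hval, b2]) (by simp [setReg_reg])
    (by simp [setReg_reg, b1, b3]) (by simp [setReg_reg, b4])
    (fun j h1 h2 => by
      have a1 : j ≠ d + 2 := by omega
      have a2 : j ≠ d + 3 := by omega
      simp [setReg_reg, a1, a2, h2])
  refine ⟨_, _, .seq he <| .seq (.const ..) <| .seq (.add ..) <| .seq (.const ..) <|
    .seq he5 <| .seq (.const ..) <| .seq (.add ..) (.add ..), ?_, ?_, fun i hi => ?_, ?_⟩
  · have := Nat.mul_le_mul_right (U L + 5) (hL _ _ _ hV)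
    omega
  · simp [r1]
  · have a1 : i ≠ d := by omega
    have a2 : i ≠ d + 4 := by omega
    have a3 : d + 2 ≠ d + 4 := by omega
    have := hreg i (by omega)
    by_cases h2 : i = size Γ
    · subst h2
      simp [setReg_reg, a1, r2, this]
    · simp [setReg_reg, a1, a2, h2, r4 i hi h2, this]
  · have a1 : d + 3 ≠ size Γ := by omega
    have a2 : d + 4 ≠ size Γ := by omega
    simp [setReg_reg, a1, a2, r3]

end Realizes

/-! ### Derived constructions: sums, decisions and bounded quantifiers. -/

section Derived

variable {Γ : Type} [RegContext Γ] {V : (ℕ → ℕ) → Γ → ℕ → Prop}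

theorem RealizesExpr.congr {f g : (ℕ → ℕ) → Γ → ℕ} (h : RealizesExpr V f)
    (hf : ∀ m γ L, V m γ L → f m γ = g m γ) : RealizesExpr V g :=
  Realizes.congr h (fun _ _ _ _ => rfl) hf

theorem RealizesExpr.sum {N : (ℕ → ℕ) → Γ → ℕ} {f : (ℕ → ℕ) → Γ → ℕ → ℕ}
    (hN : RealizesExpr V N) (hL : ∀ m γ L, V m γ L → N m γ ≤ L)
    (hf : RealizesExpr (Γ := Γ × ℕ) (fun m p L => V m p.1 L) (fun m p => f m p.1 p.2)) :
    RealizesExpr V fun m γ => ∑ i ∈ Finset.range (N m γ), f m γ i := by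
  have hid : ∀ (m : ℕ → ℕ) N, foldUpTo (fun m _ => m) m N = m := by
    intro m N
    induction N with
    | zero => rfl
    | succ N ih => exact ih
  refine (Realizes.loop hN hf hL fun m γ L hV i _ => ?_).congr (fun m γ L _ => ?_)
    (fun m γ L _ => ?_)
  · simpa only [hid] using hV
  · simp only [hid]
  · simp only [hid]

theorem RealizesMem.loop {N : (ℕ → ℕ) → Γ → ℕ} {F : (ℕ → ℕ) → Γ → ℕ → ℕ → ℕ}
    {W : (ℕ → ℕ) → Γ × ℕ → ℕ → Prop} (hN : RealizesExpr V N)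
    (hF : RealizesMem (Γ := Γ × ℕ) W fun m p => F m p.1 p.2) (hL : ∀ m γ L, V m γ L → N m γ ≤ L)
    (hW : ∀ m γ L, V m γ L → ∀ i < N m γ, W (foldUpTo (fun m i => F m γ i) m i) (γ, i) L) :
    RealizesMem V (fun m γ => foldUpTo (fun m i => F m γ i) m (N m γ)) :=
  (Realizes.loop hN hF hL hW).congr (fun _ _ _ _ => rfl) (fun _ _ _ _ => by simp)

/-- Multiplication is repeated addition, which is why the first factor has to be bounded by `L`. -/
theorem RealizesExpr.mul {a b : (ℕ → ℕ) → Γ → ℕ} (ha : RealizesExpr V a)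
    (hb : RealizesExpr V b) (hL : ∀ m γ L, V m γ L → a m γ ≤ L) :
    RealizesExpr V fun m γ => a m γ * b m γ :=
  (RealizesExpr.sum ha hL (f := fun m γ _ => b m γ) (Realizes.weaken hb)).congr fun _ _ _ _ => by simp

open Classical in
/-- There is a polynomial time program that decides `P`. -/
def RealizesProp (V : (ℕ → ℕ) → Γ → ℕ → Prop) (P : (ℕ → ℕ) → Γ → Prop) : Prop :=
  RealizesExpr V fun m γ => if P m γ then 1 else 0

theorem RealizesExpr.ite {P : (ℕ → ℕ) → Γ → Prop} {f g : (ℕ → ℕ) → Γ → ℕ}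
    [∀ m γ, Decidable (P m γ)]
    (hP : RealizesProp V P) (hf : RealizesExpr V f) (hg : RealizesExpr V g) :
    RealizesExpr V fun m γ => if P m γ then f m γ else g m γ :=
  (Realizes.ite hP hf hg).congr (fun _ _ _ _ => by simp) (fun _ _ _ _ => by simp)

theorem RealizesMem.ite {P : (ℕ → ℕ) → Γ → Prop} {F G : (ℕ → ℕ) → Γ → ℕ → ℕ}
    [∀ m γ, Decidable (P m γ)]
    (hP : RealizesProp V P) (hF : RealizesMem V F) (hG : RealizesMem V G) :
    RealizesMem V fun m γ => if P m γ then F m γ else G m γ :=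
  (Realizes.ite hP hF hG).congr (fun _ _ _ _ => by simp) (fun _ _ _ _ => by simp)

namespace RealizesProp

open Classical in
theorem congr {P Q : (ℕ → ℕ) → Γ → Prop} (h : RealizesProp V P)
    (hPQ : ∀ m γ L, V m γ L → (P m γ ↔ Q m γ)) : RealizesProp V Q :=
  RealizesExpr.congr (V := V) (f := fun m γ => if P m γ then 1 else 0) h fun m γ L hV => by
    by_cases hq : Q m γ <;> simp [hPQ m γ L hV, hq]

open Classical in
theorem ne_zero {f : (ℕ → ℕ) → Γ → ℕ} (h : RealizesExpr V f) :
    RealizesProp V fun m γ => f m γ ≠ 0 :=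
  RealizesExpr.congr (f := fun m γ => if f m γ ≠ 0 then 1 else 0)
    (Realizes.congr (Realizes.ite h (RealizesExpr.const 1) (RealizesExpr.const 0))
      (fun _ _ _ _ => by simp) fun _ _ _ _ => rfl) fun _ _ _ _ => by congr

open Classical in
theorem not {P : (ℕ → ℕ) → Γ → Prop} (h : RealizesProp V P) : RealizesProp V fun m γ => ¬ P m γ :=
  RealizesExpr.congr (V := V) (RealizesExpr.ite h (.const 0) (.const 1))
    fun m γ _ _ => by by_cases h : P m γ <;> simp [h]

open Classical in
theorem and {P Q : (ℕ → ℕ) → Γ → Prop} (h : RealizesProp V P) (h' : RealizesProp V Q) :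
    RealizesProp V fun m γ => P m γ ∧ Q m γ :=
  RealizesExpr.congr (V := V) (RealizesExpr.ite h h' (.const 0))
    fun m γ _ _ => by by_cases h : P m γ <;> simp [h]

theorem or {P Q : (ℕ → ℕ) → Γ → Prop} (h : RealizesProp V P) (h' : RealizesProp V Q) :
    RealizesProp V fun m γ => P m γ ∨ Q m γ :=
  (h.not.and h'.not).not.congr fun _ _ _ _ => by tauto

theorem imp {P Q : (ℕ → ℕ) → Γ → Prop} (h : RealizesProp V P) (h' : RealizesProp V Q) :
    RealizesProp V fun m γ => P m γ → Q m γ :=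
  (h.not.or h').congr fun _ _ _ _ => by tauto

theorem iff {P Q : (ℕ → ℕ) → Γ → Prop} (h : RealizesProp V P) (h' : RealizesProp V Q) :
    RealizesProp V fun m γ => P m γ ↔ Q m γ :=
  ((h.imp h').and (h'.imp h)).congr fun _ _ _ _ => by tauto

theorem lt {f g : (ℕ → ℕ) → Γ → ℕ} (hf : RealizesExpr V f) (hg : RealizesExpr V g) :
    RealizesProp V fun m γ => f m γ < g m γ :=
  (ne_zero (hg.sub hf)).congr fun _ _ _ _ => by omega

theorem le {f g : (ℕ → ℕ) → Γ → ℕ} (hf : RealizesExpr V f) (hg : RealizesExpr V g) :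
    RealizesProp V fun m γ => f m γ ≤ g m γ :=
  (lt hg hf).not.congr fun _ _ _ _ => by omega

theorem eq {f g : (ℕ → ℕ) → Γ → ℕ} (hf : RealizesExpr V f) (hg : RealizesExpr V g) :
    RealizesProp V fun m γ => f m γ = g m γ :=
  ((le hf hg).and (le hg hf)).congr fun _ _ _ _ => by omega

/-- The quantifier is decided by counting the witnesses. -/
theorem ex {N : (ℕ → ℕ) → Γ → ℕ} {P : (ℕ → ℕ) → Γ → ℕ → Prop}
    (hN : RealizesExpr V N) (hL : ∀ m γ L, V m γ L → N m γ ≤ L)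
    (hP : RealizesProp (Γ := Γ × ℕ) (fun m p L => V m p.1 L) (fun m p => P m p.1 p.2)) :
    RealizesProp V fun m γ => ∃ i < N m γ, P m γ i := by
  classical
  refine (ne_zero (RealizesExpr.sum hN hL (f := fun m γ i => if P m γ i then 1 else 0) ?_)).congr
    fun m γ L hV => ?_
  · exact hP
  · simp

theorem all {N : (ℕ → ℕ) → Γ → ℕ} {P : (ℕ → ℕ) → Γ → ℕ → Prop}
    (hN : RealizesExpr V N) (hL : ∀ m γ L, V m γ L → N m γ ≤ L)
    (hP : RealizesProp (Γ := Γ × ℕ) (fun m p L => V m p.1 L) (fun m p => P m p.1 p.2)) :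
    RealizesProp V fun m γ => ∀ i < N m γ, P m γ i :=
  (ex (P := fun m γ i => ¬ P m γ i) hN hL hP.not).not.congr fun m γ L hV => by push Not; rfl

end RealizesProp

end Derived

/-! ## Signatures of partial solutions -/

section Signature

variable {V Q : Type*} (τ : V → Q) (δ : V → V → ℕ) (col rank : V → ℕ)

/-- The vertices of rank below `k`. -/
def seen (k : ℕ) : Set V := {w | rank w < k}

/-- The vertices whose color class has been seen completely. -/
def finished (k : ℕ) : Set V := {w | ∀ y, col y = col w → rank y < k}

/-- The part of `S` with the color of `w` contains a vertex that is at least as close to `w` as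
all other vertices that have the type of a vertex in `R`. -/
def Served (R S : Set V) (w : V) : Prop :=
  w ∈ S ∨ ∃ y ∈ S, col y = col w ∧ ∀ z, z ≠ w → τ z ∈ τ '' R → δ w y ≤ δ w z

/-- The information on a partial solution that determines which extensions of it are solutions. -/
noncomputable def signature (k : ℕ) (R S : Set V) : Set Q × Set Q × Set Q × Set Q × Prop × ℕ :=
  (τ '' R, τ '' S, τ '' (S ∩ (seen rank k \ finished col rank k)),
    τ '' ((seen rank k \ finished col rank k) \ S), ∀ w ∈ finished col rank k, Served τ δ col R S w,
    S.ncard)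

variable {τ δ col rank}

/-- For a color class `K` and the part `s` of a solution inside it, being served depends only on the
types met by `s` and by `K \ s`: an unchosen `w'` has a twin `w` in `K \ s`, and a twin `y'` in `s'`
of the vertex serving `w` serves `w'`. -/
theorem served_of_image_eq (hsymm : ∀ u v, δ u v = δ v u)
    (htwin : ∀ u v w, τ u = τ v → w ≠ u → w ≠ v → δ u w = δ v w) {K s s' : Set V} {T : Set Q}
    (hs : τ '' s = τ '' s') (hK : τ '' (K \ s) = τ '' (K \ s'))
    (h : ∀ w ∈ K, w ∈ s ∨ ∃ y ∈ s, ∀ z, z ≠ w → τ z ∈ T → δ w y ≤ δ w z) :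
    ∀ w ∈ K, w ∈ s' ∨ ∃ y ∈ s', ∀ z, z ≠ w → τ z ∈ T → δ w y ≤ δ w z := by
  intro w' hw'
  by_cases hws : w' ∈ s'
  · exact .inl hws
  obtain ⟨w, ⟨hwK, hw⟩, hww⟩ : τ w' ∈ τ '' (K \ s) := hK ▸ ⟨w', ⟨hw', hws⟩, rfl⟩
  obtain hws | ⟨y, hy, hnear⟩ := h w hwK
  · exact absurd hws hw
  obtain ⟨y', hy', hyy⟩ : τ y ∈ τ '' s' := hs ▸ ⟨y, hy, rfl⟩
  refine .inr ⟨y', hy', fun z hz hzT => ?_⟩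
  have hyw : y ≠ w := fun e => hw (e ▸ hy)
  have hyw' : y' ≠ w' := fun e => hws (e ▸ hy')
  -- Both endpoints are replaced by twins, one after the other. The twin law does not apply when the
  -- fixed vertex is one of those exchanged, hence the separate case `y = w'`, in which all four
  -- vertices have one type.
  have e1 : δ w' y' = δ w y := by
    by_cases e : y = w'
    · subst e
      by_cases e' : y' = w
      · subst e'
        exact hsymm _ _
      · rw [hsymm w y]
        rw [hsymm y y', hsymm y w]
        exact htwin _ _ _ (hyy.trans hww.symm) hyw'.symm hyw
    · rw [htwin w w' y hww hyw e, hsymm, hsymm w' y]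
      exact htwin _ _ _ hyy hyw'.symm (Ne.symm e)
  rw [e1]
  -- The comparison with `z = w` is not available at `w` itself, but `w'` has the same type and the
  -- pair `w`, `w'` is the same seen from the other end. Here it matters that the condition ranges
  -- over all vertices of the guessed types.
  by_cases e : z = w
  · subst e
    by_cases e' : z = w'
    · exact absurd e' hz
    · rw [hsymm w' z]
      exact hnear w' (Ne.symm e') (hww ▸ hzT)
  · rw [← htwin w w' z hww e hz]
    exact hnear z e hzT

/-- While no vertex has been decided for `S`, no class is finished, so the guess `R` enters only
through its types. -/
theorem signature_insert_left {R R' S S' : Set V} (A : Set V)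
    (h : signature τ δ col rank 0 R S = signature τ δ col rank 0 R' S') :
    signature τ δ col rank 0 (R ∪ A) S = signature τ δ col rank 0 (R' ∪ A) S' := by
  have hd : finished col rank 0 = ∅ := by
    ext w
    simp only [finished, not_lt_zero, Set.mem_ofPred_eq, Set.mem_empty_iff_false, iff_false]
    exact fun h => h w rfl
  simp only [signature, Prod.mk.injEq, Set.image_union, hd] at h ⊢
  refine ⟨by rw [h.1], h.2.1, h.2.2.1, h.2.2.2.1, by simp, h.2.2.2.2.2⟩

/-- A finished color has all its vertices at rank below `k`, so vertices of rank `k` serve nobody of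
that color. -/
theorem served_union_iff {R S C : Set V} {k : ℕ} (hC : ∀ w ∈ C, rank w = k) :
    (∀ w ∈ finished col rank k, Served τ δ col R (S ∪ C) w) ↔
      ∀ w ∈ finished col rank k, Served τ δ col R S w := by
  refine forall₂_congr fun w hw => ?_
  have h1 : ∀ y ∈ C, col y ≠ col w := fun y hy e => (hw y e).ne (hC y hy)
  have h2 : w ∉ C := fun h => h1 w h rfl
  unfold Served
  constructor
  · rintro ((h | h) | ⟨y, h | h, e, h'⟩)
    · exact .inl h
    · exact absurd h h2
    · exact .inr ⟨y, h, e, h'⟩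
    · exact absurd e (h1 y h)
  · rintro (h | ⟨y, h, e, h'⟩)
    · exact .inl (.inl h)
    · exact .inr ⟨y, .inl h, e, h'⟩

/-- The signature is a right congruence: the new signature is determined by the old one and the
decision `C` at rank `k`. Either rank `k` completes a color class, and its unserved members are
judged from the recorded types, or it merely enlarges the current class. -/
theorem signature_union_right [Finite V] (hsymm : ∀ u v, δ u v = δ v u)
    (htwin : ∀ u v w, τ u = τ v → w ≠ u → w ≠ v → δ u w = δ v w)
    (hmono : ∀ u v, col u < col v → rank u < rank v) {R R' S S' C : Set V} {k : ℕ}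
    (hS : S ⊆ seen rank k) (hS' : S' ⊆ seen rank k) (hC : ∀ w ∈ C, rank w = k)
    (h : signature τ δ col rank k R S = signature τ δ col rank k R' S') :
    signature τ δ col rank (k + 1) R (S ∪ C) = signature τ δ col rank (k + 1) R' (S' ∪ C) := by
  simp only [signature, Prod.mk.injEq] at h ⊢
  obtain ⟨h1, h2, h3, h4, h5, h6⟩ := h
  -- Each color class is an interval of ranks.
  have hcol : ∀ u v w, col u = col w → rank u ≤ rank v → rank v ≤ rank w → col v = col u := by
    intro u v w e huv hvw
    have a1 := mt (hmono v u) (by omega)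
    have a2 := mt (hmono w v) (by omega)
    omega
  have hdisj : ∀ S, S ⊆ seen rank k → Disjoint S C := fun S hS =>
    Set.disjoint_left.2 fun w h1 h2 => (hS h1 : rank w < k).ne (hC w h2)
  refine ⟨h1, by rw [Set.image_union, h2, Set.image_union], ?_⟩
  rw [Set.ncard_union_eq (hdisj S hS), Set.ncard_union_eq (hdisj S' hS'), h6]
  set L : Set V := {w | rank w = k} with hLdef
  have hdone : finished col rank k ⊆ finished col rank (k + 1) := fun w hw y e => (hw y e).trans (by omega)
  by_cases hv : ∃ v, rank v = k ∧ v ∈ finished col rank (k + 1)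
  · obtain ⟨v, hvk, hvd⟩ := hv
    have hcur : seen rank (k + 1) \ finished col rank (k + 1) = ∅ := by
      ext w
      simp only [Set.mem_sdiff, Set.mem_empty_iff_false, iff_false, not_and, not_not]
      intro hw
      by_contra hnd
      obtain ⟨y, hy, hyk⟩ : ∃ y, col y = col w ∧ k + 1 ≤ rank y := by
        simpa [finished] using hnd
      have hwk : rank w < k + 1 := hw
      have e := hcol w v y hy.symm (by omega) (by omega)
      exact hnd fun y hy => hvd y (hy.trans e.symm)
    -- `K` turns out to be the entire color class of `v`; completing it leaves no current class.
    set K : Set V := (seen rank k \ finished col rank k) ∪ L with hKdef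
    have hKcol : ∀ w ∈ K, col w = col v := by
      rintro w (⟨hw, hwd⟩ | hw)
      · obtain ⟨y, hy, hyk⟩ : ∃ y, col y = col w ∧ k ≤ rank y := by simpa [finished] using hwd
        have hw : rank w < k := hw
        exact (hcol w v y hy.symm (by omega) (by omega)).symm
      · have hw : rank w = k := hw
        exact hcol v w v rfl (by omega) (by omega)
    have hK : ∀ w, col w = col v → w ∈ K := by
      intro w hw
      have hwk : rank w < k + 1 := hvd w hw
      by_cases e : rank w = k
      · exact .inr e
      · refine .inl ⟨(by omega : rank w < k), fun hd => ?_⟩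
        have := hd v hw.symm
        omega
    have hsplit : finished col rank (k + 1) = finished col rank k ∪ K := by
      ext w
      constructor
      · intro hw
        by_cases hwd : w ∈ finished col rank k
        · exact .inl hwd
        · right
          have hwk : rank w < k + 1 := hw w rfl
          by_cases e : rank w = k
          · exact .inr e
          · exact .inl ⟨(by omega : rank w < k), hwd⟩
      · rintro (hw | hw)
        · exact hdone hw
        · intro y hy
          exact hvd y (hy.trans (hKcol w hw))
    have himg : ∀ S, S ⊆ seen rank k → (S ∪ C) ∩ K = (S ∩ (seen rank k \ finished col rank k)) ∪ C := by
      intro S hS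
      ext w
      simp only [Set.mem_inter_iff, Set.mem_union, hKdef]
      constructor
      · rintro ⟨hw | hw, hw' | hw'⟩
        · exact .inl ⟨hw, hw'⟩
        · exact absurd hw' (hS hw : rank w < k).ne
        · exact .inr hw
        · exact .inr hw
      · rintro (⟨hw, hw'⟩ | hw)
        · exact ⟨.inl hw, .inl hw'⟩
        · exact ⟨.inr hw, .inr (hC w hw)⟩
    have himg' : ∀ S, S ⊆ seen rank k →
        K \ ((S ∪ C) ∩ K) = ((seen rank k \ finished col rank k) \ S) ∪ (L \ C) := by
      intro S hS
      ext w
      have a1 : w ∈ L → w ∉ S := fun h h' => (hS h' : rank w < k).ne h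
      have a2 : w ∈ C → w ∉ seen rank k := fun h h' => (h' : rank w < k).ne (hC w h)
      simp only [Set.mem_sdiff, Set.mem_inter_iff, Set.mem_union, hKdef]
      tauto
    -- Since `K` is a full color class, the color condition in `Served` amounts to membership in
    -- `K`.
    have hserved : ∀ R S, (∀ w ∈ K, Served τ δ col R (S ∪ C) w) ↔
        ∀ w ∈ K, w ∈ (S ∪ C) ∩ K ∨ ∃ y ∈ (S ∪ C) ∩ K, ∀ z, z ≠ w → τ z ∈ τ '' R →
          δ w y ≤ δ w z := by
      intro R S
      refine forall₂_congr fun w hw => ?_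
      unfold Served
      constructor
      · rintro (h | ⟨y, hy, e, h⟩)
        · exact .inl ⟨h, hw⟩
        · exact .inr ⟨y, ⟨hy, hK y (e.trans (hKcol w hw))⟩, h⟩
      · rintro (h | ⟨y, hy, h⟩)
        · exact .inl h.1
        · exact .inr ⟨y, hy.1, (hKcol y hy.2).trans (hKcol w hw).symm, h⟩
    refine ⟨by simp [hcur], by simp [hcur], ?_, rfl⟩
    rw [hsplit]
    simp only [Set.mem_union, or_imp, forall_and]
    refine congrArg₂ And ?_ ?_
    · rw [← iff_eq_eq, served_union_iff hC, served_union_iff hC, h5]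
    · rw [← iff_eq_eq, hserved, hserved, h1]
      have e1 : τ '' ((S ∪ C) ∩ K) = τ '' ((S' ∪ C) ∩ K) := by
        rw [himg S hS, himg S' hS', Set.image_union, Set.image_union, h3]
      have e2 : τ '' (K \ ((S ∪ C) ∩ K)) = τ '' (K \ ((S' ∪ C) ∩ K)) := by
        rw [himg' S hS, himg' S' hS', Set.image_union, Set.image_union, h4]
      exact ⟨served_of_image_eq hsymm htwin e1 e2, served_of_image_eq hsymm htwin e1.symm e2.symm⟩
  -- No class is completed: only the chosen and rejected types of the current class change.
  · have hd : finished col rank (k + 1) = finished col rank k := by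
      refine Set.Subset.antisymm (fun w hw y e => ?_) hdone
      have := hw y e
      by_contra hk
      exact hv ⟨y, by omega, fun y' e' => hw y' (e'.trans e)⟩
    have hcur : seen rank (k + 1) \ finished col rank (k + 1) =
        (seen rank k \ finished col rank k) ∪ L := by
      rw [hd]
      ext w
      simp only [seen, Set.mem_sdiff, Set.mem_ofPred_eq, Set.mem_union, hLdef]
      constructor
      · rintro ⟨h, h'⟩
        by_cases e : rank w = k
        · exact .inr e
        · exact .inl ⟨by omega, h'⟩
      · rintro (⟨h, h'⟩ | h)
        · exact ⟨by omega, h'⟩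
        · exact ⟨by omega, fun hd => (hd w rfl).ne h⟩
    have himg : ∀ S, S ⊆ seen rank k → (S ∪ C) ∩ ((seen rank k \ finished col rank k) ∪ L) =
        (S ∩ (seen rank k \ finished col rank k)) ∪ C := by
      intro S hS
      ext w
      have a1 : w ∈ L → w ∉ S := fun h h' => (hS h' : rank w < k).ne h
      have a2 : w ∈ C → w ∉ seen rank k := fun h h' => (h' : rank w < k).ne (hC w h)
      have a3 : w ∈ C → w ∈ L := fun h => hC w h
      simp only [Set.mem_sdiff, Set.mem_inter_iff, Set.mem_union]
      tauto
    have himg' : ∀ S, S ⊆ seen rank k → ((seen rank k \ finished col rank k) ∪ L) \ (S ∪ C) =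
        ((seen rank k \ finished col rank k) \ S) ∪ (L \ C) := by
      intro S hS
      ext w
      have a1 : w ∈ L → w ∉ S := fun h h' => (hS h' : rank w < k).ne h
      have a2 : w ∈ C → w ∉ seen rank k := fun h h' => (h' : rank w < k).ne (hC w h)
      simp only [Set.mem_sdiff, Set.mem_union]
      tauto
    rw [hcur, hd]
    refine ⟨?_, ?_, ?_, rfl⟩
    · rw [himg S hS, himg S' hS', Set.image_union, Set.image_union, h3]
    · rw [himg' S hS, himg' S' hS', Set.image_union, Set.image_union, h4]
    · rw [← iff_eq_eq, served_union_iff hC, served_union_iff hC, h5]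

/-- Partial solutions with the signature of a solution are solutions. -/
theorem exists_near_of_signature_eq
    (htwin : ∀ u v w, τ u = τ v → w ≠ u → w ≠ v → δ u w = δ v w)
    (hself : ∀ v w, δ v v ≤ δ v w) {k : ℕ} (hk : ∀ w, rank w < k) (hsymm : ∀ u v, δ u v = δ v u)
    {R S U : Set V} (hU : ∀ w, ∃ y ∈ U, col y = col w ∧ ∀ z ∈ U, δ w y ≤ δ w z)
    (h : signature τ δ col rank k R S = signature τ δ col rank k U U) :
    (∀ w, ∃ y ∈ S, col y = col w ∧ ∀ z ∈ S, δ w y ≤ δ w z) ∧ S.ncard = U.ncard := by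
  simp only [signature, Prod.mk.injEq] at h
  obtain ⟨h1, h2, -, -, h5, h6⟩ := h
  have hall : ∀ w, w ∈ finished col rank k := fun w y _ => hk y
  refine ⟨fun w => ?_, h6⟩
  -- With the correct guess `R = U`, nearness within `U` extends to all vertices of the types of
  -- `U`, because such a vertex is as far from `w` as its twin in `U`.
  have hUs : ∀ w ∈ finished col rank k, Served τ δ col U U w := by
    intro w _
    by_cases hw : w ∈ U
    · exact .inl hw
    obtain ⟨y, hy, e, hn⟩ := hU w
    refine .inr ⟨y, hy, e, ?_⟩
    rintro z hz ⟨z', hz', ezz⟩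
    rw [hsymm w z, ← htwin z' z w ezz (fun e => hw (e ▸ hz')) (Ne.symm hz), hsymm z' w]
    exact hn z' hz'
  -- Equality with the signature of `(U, U)` forces `R` and `S` to meet the same types, so the guess
  -- was correct and being served means having a nearest neighbor of the right color in `S`.
  obtain hw | ⟨y, hy, e, hn⟩ := (iff_of_eq h5).2 hUs w (hall w)
  · exact ⟨w, hw, rfl, fun z _ => hself w z⟩
  · by_cases hw : w ∈ S
    · exact ⟨w, hw, rfl, fun z _ => hself w z⟩
    · exact ⟨y, hy, e, fun z hz => hn z (fun e => hw (e ▸ hz)) (h1.trans h2.symm ▸ ⟨z, hz, rfl⟩)⟩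

/-- Four sets of types, one truth value, and a size between `0` and the number of vertices. -/
theorem card_le_of_injOn_signature [Finite V] [Finite Q] {ι : Type*} (s : Finset ι) (k : ℕ)
    (R S : ι → Set V) (h : Set.InjOn (fun i => signature τ δ col rank k (R i) (S i)) s) :
    s.card ≤ 2 ^ (4 * Nat.card Q + 1) * (Nat.card V + 1) := by
  classical
  have := Fintype.ofFinite Q
  have := Fintype.ofFinite V
  let t : Finset (Set Q × Set Q × Set Q × Set Q × Prop × ℕ) :=
    Finset.univ ×ˢ Finset.univ ×ˢ Finset.univ ×ˢ Finset.univ ×ˢ Finset.univ ×ˢ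
      Finset.range (Nat.card V + 1)
  calc s.card ≤ t.card := by
        refine Finset.card_le_card_of_injOn _ (fun i _ => ?_) h
        have := Set.ncard_le_card (S i)
        simp only [t, signature, Finset.coe_product, Finset.coe_univ, Finset.coe_range,
          Set.mem_prod, Set.mem_univ, true_and, Set.mem_Iio]
        omega
    _ = 2 ^ (4 * Nat.card Q + 1) * (Nat.card V + 1) := by
        simp only [t, Finset.card_product, Finset.card_univ, Fintype.card_set, Finset.card_range,
          Fintype.card_prop, Nat.card_eq_fintype_card]
        ring

end Signature

/-! ## Types of vertices and truncated distances -/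

section Types

variable {V : Type*} {G : SimpleGraph V}

theorem sameType_iff {u v : V} :
    SameType G u v ↔ ∀ z, z ≠ u → z ≠ v → (G.Adj u z ↔ G.Adj v z) := by
  simp only [SameType, Set.ext_iff, Set.mem_sdiff, SimpleGraph.mem_neighborSet,
    Set.mem_singleton_iff]
  refine forall_congr' fun z => ?_
  by_cases h1 : z = u
  · subst h1; simp
  by_cases h2 : z = v
  · subst h2; simp
  simp [h1, h2, Iff.comm]

variable (G) in
/-- Being of the same type is an equivalence relation. -/
def typeSetoid : Setoid V where
  r := SameType G
  iseqv :=
    { refl := fun _ => rfl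
      symm := fun h => Eq.symm h
      trans := by
        intro u v w h1 h2
        rw [sameType_iff] at *
        intro z hu hw
        -- At `z = v` neither hypothesis applies directly; the adjacencies among the three vertices
        -- are compared by way of the pair `u`, `w`.
        by_cases hv : z = v
        · subst hv
          by_cases huw : u = w
          · rw [huw]
          · have a1 := h1 w (Ne.symm huw) (Ne.symm hw)
            have a2 := h2 u (Ne.symm hu) huw
            rw [G.adj_comm z u, G.adj_comm w u, a1] at a2
            rw [a2, G.adj_comm]
        · exact (h1 z hu hv).trans (h2 z hv hw) }

/-- Each part of a decomposition lies within one type, so sending parts to types is surjective. -/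
theorem card_types_le [Fintype V] [DecidableEq V] :
    Nat.card (Quotient (typeSetoid G)) ≤ neighborhoodDiversity G := by
  -- The partition into singletons is a decomposition, so the infimum is attained and not the
  -- default value `0`.
  have hne : {w : ℕ | ∃ P : Finpartition (Finset.univ : Finset V),
      IsNeighborhoodDecomposition G P ∧ P.parts.card = w}.Nonempty := by
    refine ⟨_, ⊥, ?_, rfl⟩
    intro C hC u hu v hv
    obtain ⟨a, -, rfl⟩ := Finpartition.mem_bot_iff.1 hC
    rw [Finset.mem_singleton] at hu hv
    rw [hu, hv]
    rfl
  obtain ⟨P, hP, hcard⟩ := Nat.sInf_mem hne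
  unfold neighborhoodDiversity
  rw [← hcard, ← Nat.card_eq_finsetCard P.parts]
  refine Nat.card_le_card_of_surjective
    (fun C : P.parts => Quotient.mk (typeSetoid G) (P.nonempty_of_mem_parts C.2).choose) ?_
  intro q
  induction q using Quotient.inductionOn with
  | h v =>
    obtain ⟨C, hC, hv⟩ := P.exists_mem (Finset.mem_univ v)
    exact ⟨⟨C, hC⟩, Quotient.sound (hP C hC _ (P.nonempty_of_mem_parts hC).choose_spec v hv)⟩

/-- Exchanging two vertices of the same type is an automorphism. -/
def swapIso [DecidableEq V] {u v : V} (h : SameType G u v) : G ≃g G where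
  toEquiv := Equiv.swap u v
  map_rel_iff' := by
    rw [sameType_iff] at h
    intro a b
    simp only [Equiv.swap_apply_def]
    have := G.adj_comm
    have : ∀ a, ¬ G.Adj a a := fun a => G.irrefl
    grind

theorem edist_map_le {W : Type*} {H : SimpleGraph W} (f : G →g H) (a b : V) :
    H.edist (f a) (f b) ≤ G.edist a b := by
  by_cases h : G.edist a b = ⊤
  · rw [h]
    exact le_top
  · obtain ⟨p, hp⟩ := SimpleGraph.exists_walk_of_edist_ne_top h
    rw [← hp, ← SimpleGraph.Walk.length_map f p]
    exact SimpleGraph.edist_le _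

theorem edist_eq_of_sameType {u v w : V} (h : SameType G u v) (hu : w ≠ u) (hv : w ≠ v) :
    G.edist u w = G.edist v w := by
  classical
  have hw : Equiv.swap u v w = w := Equiv.swap_apply_of_ne_of_ne hu hv
  have h1 := edist_map_le (swapIso h).toHom u w
  have h2 := edist_map_le (swapIso h).toHom v w
  have e1 : (swapIso h) u = v := Equiv.swap_apply_left u v
  have e2 : (swapIso h) v = u := Equiv.swap_apply_right u v
  have e3 : (swapIso h) w = w := hw
  have h1 : G.edist ((swapIso h) u) ((swapIso h) w) ≤ G.edist u w := h1
  have h2 : G.edist ((swapIso h) v) ((swapIso h) w) ≤ G.edist v w := h2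
  rw [e1, e3] at h1
  rw [e2, e3] at h2
  exact le_antisymm h2 h1

end Types

/-! ### Truncated distances and the recursion of breadth first search. -/

section Distance

variable {n : ℕ} (G : SimpleGraph (Fin n))

open Classical in
/-- The distance, where distances larger than `k` are replaced by `n`. -/
noncomputable def distUpTo (k : ℕ) (u v : Fin n) : ℕ :=
  if G.edist u v ≤ k then (G.edist u v).toNat else n

variable {G}

theorem distUpTo_eq {k j : ℕ} {u v : Fin n} (hj : j < n) :
    distUpTo G k u v = j ↔ G.edist u v = j ∧ j ≤ k := by
  unfold distUpTo
  split_ifs with h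
  · obtain ⟨d, hd⟩ := ENat.ne_top_iff_exists.1 (ne_top_of_le_ne_top (ENat.natCast_ne_top k) h)
    rw [← hd] at h ⊢
    norm_cast at h ⊢
    simp only [ENat.toNat_natCast]
    omega
  · constructor
    · intro h; omega
    · rintro ⟨h1, h2⟩
      exact absurd (h1 ▸ by exact_mod_cast h2) h

theorem distUpTo_zero (u v : Fin n) : distUpTo G 0 u v = if u = v then 0 else n := by
  simp only [distUpTo, Nat.cast_zero, nonpos_iff_eq_zero, SimpleGraph.edist_eq_zero_iff]
  split_ifs with h
  · simp [h]
  · rfl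

/-- Cut off, or append, the last edge of a shortest walk. -/
theorem edist_eq_succ_of_adj {V : Type*} {G : SimpleGraph V} {k : ℕ} {u v : V} :
    G.edist u v = (k + 1 : ℕ) ↔ ¬ G.edist u v ≤ k ∧ ∃ w, G.edist u w = k ∧ G.Adj w v := by
  constructor
  · intro h
    refine ⟨?_, ?_⟩
    · rw [h]; norm_cast; omega
    obtain ⟨p, hp⟩ := SimpleGraph.exists_walk_of_edist_eq_coe h
    have hnil : ¬ p.Nil := by
      rw [← SimpleGraph.Walk.length_eq_zero_iff]; omega
    refine ⟨p.penultimate, le_antisymm ?_ ?_, p.adj_penultimate hnil⟩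
    · have := SimpleGraph.edist_le p.dropLast
      rwa [SimpleGraph.Walk.length_dropLast, hp, Nat.add_sub_cancel] at this
    · by_contra hlt
      push Not at hlt
      obtain ⟨j, hj⟩ := ENat.ne_top_iff_exists.1 hlt.ne_top
      obtain ⟨q, hq⟩ := SimpleGraph.exists_walk_of_edist_eq_coe hj.symm
      have := SimpleGraph.edist_le (q.concat (p.adj_penultimate hnil))
      rw [h, SimpleGraph.Walk.length_concat, hq] at this
      rw [← hj] at hlt
      norm_cast at this hlt
      omega
  · rintro ⟨h, w, hw, hwv⟩
    obtain ⟨q, hq⟩ := SimpleGraph.exists_walk_of_edist_eq_coe hw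
    have h1 := SimpleGraph.edist_le (q.concat hwv)
    rw [SimpleGraph.Walk.length_concat, hq] at h1
    obtain ⟨j, hj⟩ := ENat.ne_top_iff_exists.1 (ne_top_of_le_ne_top (ENat.natCast_ne_top _) h1)
    rw [← hj] at h h1 ⊢
    norm_cast at h h1 ⊢
    omega

/-- One round of breadth first search; the value `n` marks pairs not reached so far. -/
theorem distUpTo_succ {k : ℕ} (hk : k < n) (u v : Fin n) [Decidable (distUpTo G k u v = n ∧
    ∃ w, distUpTo G k u w = k ∧ G.Adj w v)] :
    distUpTo G (k + 1) u v =
      if distUpTo G k u v = n ∧ ∃ w, distUpTo G k u w = k ∧ G.Adj w v then k + 1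
      else distUpTo G k u v := by
  have hn : distUpTo G k u v = n ↔ ¬ G.edist u v ≤ k := by
    constructor
    · intro h hle
      obtain ⟨j, hj⟩ := ENat.ne_top_iff_exists.1 (ne_top_of_le_ne_top (ENat.natCast_ne_top k) hle)
      rw [distUpTo, if_pos hle, ← hj] at h
      rw [← hj] at hle
      norm_cast at hle
      simp only [ENat.toNat_natCast] at h
      omega
    · intro h
      rw [distUpTo, if_neg h]
  have hiff : (distUpTo G k u v = n ∧ ∃ w, distUpTo G k u w = k ∧ G.Adj w v) ↔
      G.edist u v = (k + 1 : ℕ) := by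
    simp only [hn, distUpTo_eq hk, le_refl, and_true, edist_eq_succ_of_adj]
  split_ifs with h <;> rw [hiff] at h
  · rw [distUpTo, h, if_pos le_rfl, ENat.toNat_natCast]
  · unfold distUpTo
    have : G.edist u v ≤ (k + 1 : ℕ) ↔ G.edist u v ≤ k := by
      rw [le_iff_lt_or_eq, or_iff_left h, Nat.cast_add, Nat.cast_one]
      exact ENat.lt_natCast_add_one_iff
    simp only [this]

/-- Finite distances are smaller than `n`, since a path has fewer than `n` edges; so `n` can stand
for infinity in every comparison. -/
theorem distUpTo_le_iff (u v w : Fin n) :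
    distUpTo G n u v ≤ distUpTo G n u w ↔ G.edist u v ≤ G.edist u w := by
  have key : ∀ v, (∃ j < n, G.edist u v = j ∧ distUpTo G n u v = j) ∨
      (G.edist u v = ⊤ ∧ distUpTo G n u v = n) := by
    intro v
    by_cases h : G.edist u v = ⊤
    · right
      simp [distUpTo, h]
    · left
      obtain ⟨p⟩ := SimpleGraph.reachable_of_edist_ne_top h
      obtain ⟨j, hj⟩ := ENat.ne_top_iff_exists.1 h
      classical
      have h1 := SimpleGraph.edist_le (p.toPath : G.Walk u v)
      have h2 := p.toPath.2.length_lt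
      rw [Fintype.card_fin] at h2
      rw [← hj] at h1
      norm_cast at h1
      exact ⟨j, by omega, hj.symm, (distUpTo_eq (by omega)).2 ⟨hj.symm, by omega⟩⟩
  obtain ⟨i, hi, e1, e2⟩ | ⟨e1, e2⟩ := key v <;> obtain ⟨j, hj, e3, e4⟩ | ⟨e3, e4⟩ := key w <;>
    rw [e1, e2, e3, e4]
  · norm_cast
  · simp [hi.le]
  · simp [hj]
  · simp

theorem isConsistentSubset_iff {κ : Type*} (color : Fin n → κ) (S : Set (Fin n)) :
    IsConsistentSubset G color S ↔ ∀ w, ∃ y ∈ S, color y = color w ∧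
      ∀ z ∈ S, distUpTo G n w y ≤ distUpTo G n w z := by
  refine forall_congr' fun w => ?_
  simp only [nearestNeighbors, Set.mem_image, Set.mem_ofPred_eq, distUpTo_le_iff, distToSet]
  refine exists_congr fun y => ?_
  constructor
  · rintro ⟨⟨hy, h⟩, e⟩
    refine ⟨hy, e, fun z hz => ?_⟩
    rw [h]
    exact iInf₂_le z hz
  · rintro ⟨hy, e, h⟩
    exact ⟨⟨hy, le_antisymm (le_iInf₂ h) (iInf₂_le y hy)⟩, e⟩

end Distance

/-! ## The contents of the memory -/

/-- The color of `v` in the memory. -/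
def colorAt (m : ℕ → ℕ) (v : ℕ) : ℕ := m (2 + v)

/-- The entry of the adjacency matrix in the memory. -/
def adjAt (m : ℕ → ℕ) (u v : ℕ) : ℕ := m (2 + m 0 + (m 0 * u + v))

/-- The address of the entry of the distance table. -/
def distAddr (m : ℕ → ℕ) (u v : ℕ) : ℕ := 2 + m 0 + m 0 * m 0 + (m 0 * u + v)

/-- The entry of the distance table in the memory. -/
def distAt (m : ℕ → ℕ) (u v : ℕ) : ℕ := m (distAddr m u v)

/-- The address of a row; row `j` describes a partial solution by two indicator vectors. -/
def rowAddr (m : ℕ → ℕ) (j : ℕ) : ℕ := 2 + m 0 + m 0 * m 0 + m 0 * m 0 + (m 0 + m 0) * j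

/-- The first vector in row `j`. -/
def InFst (m : ℕ → ℕ) (j v : ℕ) : Prop := m (rowAddr m j + v) ≠ 0

/-- The second vector in row `j`. -/
def InSnd (m : ℕ → ℕ) (j v : ℕ) : Prop := m (rowAddr m j + (m 0 + v)) ≠ 0

/-- `SameType` for the graph in the memory. -/
def SameTypeAt (m : ℕ → ℕ) (u v : ℕ) : Prop :=
  ∀ z < m 0, z ≠ u → z ≠ v → (adjAt m u z ≠ 0 ↔ adjAt m v z ≠ 0)

/-- The sets `A` and `B` meet the same types. -/
def SameHits (m : ℕ → ℕ) (A B : ℕ → Prop) : Prop :=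
  ∀ w < m 0, (∃ y < m 0, A y ∧ SameTypeAt m y w) ↔ (∃ y < m 0, B y ∧ SameTypeAt m y w)

/-- The position of `v` in the order by color and index. -/
def rankAt (m : ℕ → ℕ) (v : ℕ) : ℕ :=
  ∑ w ∈ Finset.range (m 0),
    if colorAt m w < colorAt m v ∨ (colorAt m w = colorAt m v ∧ w < v) then 1 else 0

/-- The color class of `w` has been seen completely. -/
def FinishedAt (m : ℕ → ℕ) (k w : ℕ) : Prop :=
  ∀ y < m 0, colorAt m y = colorAt m w → rankAt m y < k

/-- `w` has been seen, but its color class has not been seen completely. -/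
def CurrentAt (m : ℕ → ℕ) (k w : ℕ) : Prop := rankAt m w < k ∧ ¬ FinishedAt m k w

/-- `Served` for the partial solution in row `j`. -/
def ServedAt (m : ℕ → ℕ) (j w : ℕ) : Prop :=
  InSnd m j w ∨ ∃ y < m 0, InSnd m j y ∧ colorAt m y = colorAt m w ∧
    ∀ z < m 0, z ≠ w → (∃ x < m 0, InFst m j x ∧ SameTypeAt m x z) → distAt m w y ≤ distAt m w z

/-- All vertices of completely seen color classes are served. -/
def AllServedAt (m : ℕ → ℕ) (k j : ℕ) : Prop := ∀ w < m 0, FinishedAt m k w → ServedAt m j w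

open Classical in
/-- The cardinality of the second set in row `j`. -/
noncomputable def sizeAt (m : ℕ → ℕ) (j : ℕ) : ℕ :=
  ∑ v ∈ Finset.range (m 0), if InSnd m j v then 1 else 0

/-- The rows `p` and `q` have the same signature. -/
def SameSignatureAt (m : ℕ → ℕ) (k p q : ℕ) : Prop :=
  SameHits m (InFst m p) (InFst m q) ∧ SameHits m (InSnd m p) (InSnd m q) ∧
    SameHits m (fun w => InSnd m p w ∧ CurrentAt m k w)
      (fun w => InSnd m q w ∧ CurrentAt m k w) ∧
    SameHits m (fun w => CurrentAt m k w ∧ ¬ InSnd m p w)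
      (fun w => CurrentAt m k w ∧ ¬ InSnd m q w) ∧
    (AllServedAt m k p ↔ AllServedAt m k q) ∧ sizeAt m p = sizeAt m q

/-- The second set in row `j` is a consistent subset. -/
def ConsistentAt (m : ℕ → ℕ) (j : ℕ) : Prop :=
  ∀ w < m 0, ∃ y < m 0, InSnd m j y ∧ colorAt m y = colorAt m w ∧
    ∀ z < m 0, InSnd m j z → distAt m w y ≤ distAt m w z

/-- The second set in row `j` is a minimum consistent subset among the rows. -/
def BestAt (m : ℕ → ℕ) (j : ℕ) : Prop :=
  ConsistentAt m j ∧ ∀ i < m 1, ConsistentAt m i → sizeAt m j ≤ sizeAt m i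

theorem table_index_lt {n u v : ℕ} (hu : u < n) (hv : v < n) : n * u + v < n * n := by
  have := Nat.mul_le_mul_left n (Nat.succ_le_of_lt hu)
  rw [Nat.mul_succ] at this
  omega

theorem table_index_inj {n u v u' v' : ℕ} (hv : v < n) (hv' : v' < n) :
    n * u + v = n * u' + v' ↔ u = u' ∧ v = v' := by
  constructor
  · intro h
    have h1 := congrArg (· / n) h
    have h2 := congrArg (· % n) h
    simp only [Nat.mul_add_mod, Nat.mod_eq_of_lt hv, Nat.mod_eq_of_lt hv'] at h2
    simp only [Nat.mul_add_div (by omega : n > 0), Nat.div_eq_of_lt hv,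
      Nat.div_eq_of_lt hv'] at h1
    exact ⟨h1, h2⟩
  · rintro ⟨rfl, rfl⟩
    rfl

/-! ### Agreement of the memory predicates with the graph and its signatures. -/

section Base

variable {n c : ℕ} (G : SimpleGraph (Fin n)) (color : Fin n → Fin c)

/-- The memory holds the input. -/
structure HoldsInput (m : ℕ → ℕ) : Prop where
  size : m 0 = n
  color : ∀ v : Fin n, m (2 + v) = color v
  adj : ∀ u v : Fin n, m (2 + n + (n * u + v)) ≠ 0 ↔ G.Adj u v

/-- The memory holds the input and the distance table. -/
structure HoldsTables (m : ℕ → ℕ) : Prop extends HoldsInput G color m where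
  dist : ∀ u v : Fin n, m (2 + n + n * n + (n * u + v)) = distUpTo G n u v

variable {G color}

/-- Cell `1` is exempt: the number of colors is never needed, and the cell is reused for the number
of rows. -/
theorem HoldsInput.of_eq {m m' : ℕ → ℕ} (h : HoldsInput G color m)
    (hm : ∀ x, x ≠ 1 → x < 2 + n + n * n → m' x = m x) : HoldsInput G color m' where
  size := by rw [hm 0 (by omega) (by omega), h.size]
  color v := by
    have := v.2
    rw [hm _ (by omega) (by omega), h.color]
  adj u v := by
    have := table_index_lt u.2 v.2
    rw [hm _ (by omega) (by omega), h.adj]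

theorem HoldsTables.of_eq {m m' : ℕ → ℕ} (h : HoldsTables G color m)
    (hm : ∀ x, x ≠ 1 → x < 2 + n + n * n + n * n → m' x = m x) : HoldsTables G color m' where
  toHoldsInput := h.toHoldsInput.of_eq fun x h1 h2 => hm x h1 (by omega)
  dist u v := by
    have := table_index_lt u.2 v.2
    rw [hm _ (by omega) (by omega), h.dist]

/-- The position of `v` in the order by color and index. -/
def lexRank (col : Fin n → ℕ) (v : Fin n) : ℕ :=
  (Finset.univ.filter fun w => col w < col v ∨ (col w = col v ∧ w < v)).card

theorem lexRank_lt {col : Fin n → ℕ} {u v : Fin n}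
    (h : col u < col v ∨ (col u = col v ∧ u < v)) : lexRank col u < lexRank col v := by
  refine Finset.card_lt_card (Finset.ssubset_iff_of_subset (fun w => ?_) |>.2 ⟨u, ?_, ?_⟩)
  · simp only [Finset.mem_filter, Finset.mem_univ, true_and]
    omega
  · simpa using h
  · simp

theorem lexRank_injective (col : Fin n → ℕ) : Function.Injective (lexRank col) := by
  intro u v h
  by_contra hne
  have h1 := mt (@lexRank_lt n col u v) (by omega)
  have h2 := mt (@lexRank_lt n col v u) (by omega)
  omega

theorem lexRank_lt_card (col : Fin n → ℕ) (v : Fin n) : lexRank col v < n := by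
  have : lexRank col v < Fintype.card (Fin n) :=
    Finset.card_lt_univ_of_notMem (x := v) (by simp)
  simpa using this

theorem sum_range_fin (n : ℕ) (f : ℕ → ℕ) : ∑ i ∈ Finset.range n, f i = ∑ i : Fin n, f i :=
  Finset.sum_range f

theorem forall_lt_iff_fin {n : ℕ} {P : ℕ → Prop} : (∀ i < n, P i) ↔ ∀ i : Fin n, P i :=
  ⟨fun h i => h i i.2, fun h i hi => h ⟨i, hi⟩⟩

theorem exists_lt_iff_fin {n : ℕ} {P : ℕ → Prop} : (∃ i < n, P i) ↔ ∃ i : Fin n, P i :=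
  ⟨fun ⟨i, hi, h⟩ => ⟨⟨i, hi⟩, h⟩, fun ⟨i, h⟩ => ⟨i, i.2, h⟩⟩

/-- A partial solution in the memory. -/
def rowSets (n : ℕ) (m : ℕ → ℕ) (j : ℕ) : Set (Fin n) × Set (Fin n) :=
  ({v | InFst m j v}, {v | InSnd m j v})

variable (G color) in
/-- The signature of a partial solution after `t` rounds; in the first `n` rounds the first set is
chosen, in the next `n` rounds the second set. -/
noncomputable def roundSignature (t : ℕ) (X : Set (Fin n) × Set (Fin n)) :=
  signature (Quotient.mk (typeSetoid G)) (distUpTo G n) (fun v => (color v : ℕ))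
    (lexRank fun v => (color v : ℕ)) (t - n) X.1 X.2

namespace HoldsTables

variable {m : ℕ → ℕ} (h : HoldsTables G color m)
include h

theorem colorAt_eq (v : Fin n) : colorAt m v = color v := h.color v

theorem adjAt_iff (u v : Fin n) : adjAt m u v ≠ 0 ↔ G.Adj u v := by
  rw [adjAt, h.size]
  exact h.adj u v

theorem distAt_eq (u v : Fin n) : distAt m u v = distUpTo G n u v := by
  rw [distAt, distAddr, h.size]
  exact h.dist u v

theorem sameTypeAt_iff (u v : Fin n) : SameTypeAt m u v ↔
    Quotient.mk (typeSetoid G) u = Quotient.mk (typeSetoid G) v := by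
  rw [Quotient.eq, SameTypeAt, h.size, forall_lt_iff_fin]
  simp only [h.adjAt_iff, ne_eq, Fin.val_inj]
  exact sameType_iff.symm

theorem sameHits_iff (A B : ℕ → Prop) : SameHits m A B ↔
    Quotient.mk (typeSetoid G) '' {v | A v} = Quotient.mk (typeSetoid G) '' {v | B v} := by
  simp only [SameHits, h.size, forall_lt_iff_fin, exists_lt_iff_fin, h.sameTypeAt_iff]
  rw [Set.ext_iff]
  constructor
  · intro h q
    induction q using Quotient.inductionOn with
    | h w => exact h w
  · exact fun h w => h (Quotient.mk _ w)

theorem rankAt_eq (v : Fin n) : rankAt m v = lexRank (fun v => (color v : ℕ)) v := by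
  simp only [rankAt, h.size, sum_range_fin, h.colorAt_eq, lexRank, Finset.card_filter, Fin.lt_def]

theorem finishedAt_iff (k : ℕ) (w : Fin n) : FinishedAt m k w ↔
    w ∈ finished (fun v => (color v : ℕ)) (lexRank fun v => (color v : ℕ)) k := by
  simp only [FinishedAt, h.size, forall_lt_iff_fin, h.rankAt_eq, h.colorAt_eq]
  rfl

theorem currentAt_iff (k : ℕ) (w : Fin n) : CurrentAt m k w ↔
    w ∈ seen (lexRank fun v => (color v : ℕ)) k \
      finished (fun v => (color v : ℕ)) (lexRank fun v => (color v : ℕ)) k := by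
  rw [CurrentAt, h.finishedAt_iff, h.rankAt_eq]
  rfl

theorem allServedAt_iff (k j : ℕ) : AllServedAt m k j ↔
    ∀ w ∈ finished (fun v => (color v : ℕ)) (lexRank fun v => (color v : ℕ)) k,
      Served (Quotient.mk (typeSetoid G)) (distUpTo G n) (fun v => (color v : ℕ))
        (rowSets n m j).1 (rowSets n m j).2 w := by
  simp only [AllServedAt, ServedAt, h.size, forall_lt_iff_fin, exists_lt_iff_fin, h.finishedAt_iff,
    h.colorAt_eq, h.distAt_eq, h.sameTypeAt_iff, ne_eq, Fin.val_inj, Served]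
  rfl

theorem sizeAt_eq (j : ℕ) : sizeAt m j = (rowSets n m j).2.ncard := by
  classical
  rw [sizeAt, h.size, sum_range_fin, rowSets, Set.ncard_eq_toFinset_card',
    ← Finset.card_filter (fun i : Fin n => InSnd m j i) Finset.univ]
  congr 1
  ext v
  simp

theorem sameSignatureAt_iff (t p q : ℕ) : SameSignatureAt m (t - n) p q ↔
    roundSignature G color t (rowSets n m p) = roundSignature G color t (rowSets n m q) := by
  simp only [SameSignatureAt, h.sameHits_iff, h.currentAt_iff, h.allServedAt_iff, h.sizeAt_eq,
    roundSignature, signature, Prod.mk.injEq, eq_iff_iff]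
  rfl

theorem consistentAt_iff (j : ℕ) : ConsistentAt m j ↔
    IsConsistentSubset G color (rowSets n m j).2 := by
  simp only [ConsistentAt, h.size, forall_lt_iff_fin, exists_lt_iff_fin, h.colorAt_eq, h.distAt_eq,
    isConsistentSubset_iff, Fin.val_inj]
  rfl

end HoldsTables

end Base

/-! ### Rounds of decisions and the congruence property of signatures. -/

section Extension

variable {n c : ℕ} {G : SimpleGraph (Fin n)} {color : Fin n → Fin c}

variable (color) in
/-- The partial solution is contained in the part that is decided after `t` rounds. -/
def DecidedBy (t : ℕ) (X : Set (Fin n) × Set (Fin n)) : Prop :=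
  (∀ v ∈ X.1, (v : ℕ) < t) ∧ ∀ v ∈ X.2, n + lexRank (fun v => (color v : ℕ)) v < t

variable (color) in
/-- The choice of the vertex that is decided in round `t`. -/
def extend (t : ℕ) (X : Set (Fin n) × Set (Fin n)) : Set (Fin n) × Set (Fin n) :=
  (X.1 ∪ {v | (v : ℕ) = t}, X.2 ∪ {v | n + lexRank (fun v => (color v : ℕ)) v = t})

theorem DecidedBy.mono {t t' : ℕ} (htt : t ≤ t') {X : Set (Fin n) × Set (Fin n)}
    (h : DecidedBy color t X) : DecidedBy color t' X :=
  ⟨fun v hv => (h.1 v hv).trans_le htt, fun v hv => (h.2 v hv).trans_le htt⟩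

theorem DecidedBy.extend {t : ℕ} {X : Set (Fin n) × Set (Fin n)} (h : DecidedBy color t X) :
    DecidedBy color (t + 1) (extend color t X) := by
  constructor
  · rintro v (hv | hv)
    · exact (h.1 v hv).trans (by omega)
    · exact Nat.lt_succ_of_le (le_of_eq hv)
  · rintro v (hv | hv)
    · exact (h.2 v hv).trans (by omega)
    · exact Nat.lt_succ_of_le (le_of_eq hv)

theorem distUpTo_symm (k : ℕ) (u v : Fin n) : distUpTo G k u v = distUpTo G k v u := by
  simp only [distUpTo, G.edist_comm (u := u)]

theorem distUpTo_twin (k : ℕ) (u v w : Fin n)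
    (h : Quotient.mk (typeSetoid G) u = Quotient.mk (typeSetoid G) v) (hu : w ≠ u) (hv : w ≠ v) :
    distUpTo G k u w = distUpTo G k v w := by
  simp only [distUpTo, edist_eq_of_sameType (Quotient.exact h) hu hv]

/-- Rounds `t < n` can only touch the first set and later rounds only the second, so one of `A` and
`C` is empty and one of the two congruence lemmas applies. -/
theorem roundSignature_union {t : ℕ} {X Y : Set (Fin n) × Set (Fin n)} {A C : Set (Fin n)}
    (hX : DecidedBy color t X) (hY : DecidedBy color t Y)
    (hA : ∀ v ∈ A, (v : ℕ) = t)
    (hC : ∀ v ∈ C, n + lexRank (fun v => (color v : ℕ)) v = t)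
    (h : roundSignature G color t X = roundSignature G color t Y) :
    roundSignature G color (t + 1) (X.1 ∪ A, X.2 ∪ C) =
      roundSignature G color (t + 1) (Y.1 ∪ A, Y.2 ∪ C) := by
  unfold roundSignature at h ⊢
  by_cases ht : t < n
  · have hC : C = ∅ := by
      ext v
      simp only [Set.mem_empty_iff_false, iff_false]
      intro hv
      have := hC v hv
      omega
    rw [hC, Set.union_empty, Set.union_empty, show t + 1 - n = 0 by omega]
    rw [show t - n = 0 by omega] at h
    exact signature_insert_left A h
  · have hA : A = ∅ := by
      ext v
      simp only [Set.mem_empty_iff_false, iff_false]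
      intro hv
      have := hA v hv
      omega
    rw [hA, Set.union_empty, Set.union_empty, show t + 1 - n = t - n + 1 by omega]
    refine signature_union_right (distUpTo_symm n) (distUpTo_twin n)
      (fun u v h => lexRank_lt (.inl h)) (fun v hv => ?_) (fun v hv => ?_) (fun v hv => ?_) h
    · have := hX.2 v hv
      show lexRank (fun v => (color v : ℕ)) v < t - n
      omega
    · have := hY.2 v hv
      show lexRank (fun v => (color v : ℕ)) v < t - n
      omega
    · have := hC v hv
      omega

theorem roundSignature_succ {t : ℕ} {X Y : Set (Fin n) × Set (Fin n)}
    (hX : DecidedBy color t X) (hY : DecidedBy color t Y)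
    (h : roundSignature G color t X = roundSignature G color t Y) :
    roundSignature G color (t + 1) X = roundSignature G color (t + 1) Y := by
  simpa using roundSignature_union (A := ∅) (C := ∅) hX hY (by simp) (by simp) h

theorem roundSignature_extend {t : ℕ} {X Y : Set (Fin n) × Set (Fin n)}
    (hX : DecidedBy color t X) (hY : DecidedBy color t Y)
    (h : roundSignature G color t X = roundSignature G color t Y) :
    roundSignature G color (t + 1) (extend color t X) =
      roundSignature G color (t + 1) (extend color t Y) :=
  roundSignature_union hX hY (fun _ hv => hv) (fun _ hv => hv) h

/-- Each round decides exactly one entry, because ranks are injective; if that entry is chosen in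
`X`, removing it gives `Y`. -/
theorem DecidedBy.eq_extend {t : ℕ} {X : Set (Fin n) × Set (Fin n)}
    (h : DecidedBy color (t + 1) X) :
    DecidedBy color t X ∨ ∃ Y, DecidedBy color t Y ∧ X = _root_.extend color t Y := by
  by_cases h1 : ∃ v ∈ X.1, (v : ℕ) = t
  · obtain ⟨v, hv, hvt⟩ := h1
    refine .inr ⟨(X.1 \ {v}, X.2), ⟨fun u hu => ?_, fun u hu => ?_⟩, Prod.ext ?_ ?_⟩
    · have := h.1 u hu.1
      have : (u : ℕ) ≠ v := fun e => hu.2 (Fin.ext e)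
      omega
    · have := h.2 u hu
      omega
    · ext u
      have : (u : ℕ) = t ↔ u = v := by rw [← hvt, Fin.val_inj]
      simp only [_root_.extend, Set.mem_union, Set.mem_sdiff, Set.mem_singleton_iff,
        Set.mem_ofPred_eq, this]
      by_cases e : u = v
      · simp [e, hv]
      · simp [e]
    · ext u
      simp only [_root_.extend, Set.mem_union, Set.mem_ofPred_eq, iff_self_or]
      intro e
      omega
  by_cases h2 : ∃ v ∈ X.2, n + lexRank (fun v => (color v : ℕ)) v = t
  · obtain ⟨v, hv, hvt⟩ := h2
    have hinj : ∀ u, n + lexRank (fun v => (color v : ℕ)) u = t ↔ u = v := by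
      intro u
      constructor
      · intro e
        exact lexRank_injective (fun v => (color v : ℕ)) (by omega)
      · rintro rfl
        exact hvt
    refine .inr ⟨(X.1, X.2 \ {v}), ⟨fun u hu => ?_, fun u hu => ?_⟩, Prod.ext ?_ ?_⟩
    · omega
    · have := h.2 u hu.1
      have := mt (hinj u).1 hu.2
      omega
    · ext u
      simp only [_root_.extend, Set.mem_union, Set.mem_ofPred_eq, iff_self_or]
      intro e
      omega
    · ext u
      simp only [_root_.extend, Set.mem_union, Set.mem_sdiff, Set.mem_singleton_iff,
        Set.mem_ofPred_eq, hinj]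
      by_cases e : u = v
      · simp [e, hv]
      · simp [e]
  · push Not at h1 h2
    refine .inl ⟨fun v hv => ?_, fun v hv => ?_⟩
    · have := h.1 v hv
      have := h1 v hv
      omega
    · have := h.2 v hv
      have := h2 v hv
      omega

end Extension

theorem foldUpTo_induction {α : Type*} {F : α → ℕ → α} {m : α} {N : ℕ} (I : ℕ → α → Prop)
    (h0 : I 0 m) (hs : ∀ i < N, ∀ a, I i a → I (i + 1) (F a i)) :
    ∀ i ≤ N, I i (foldUpTo F m i) := by
  intro i
  induction i with
  | zero => exact fun _ => h0
  | succ i ih => exact fun hi => hs i (by omega) _ (ih (by omega))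

/-! ## The search -/

/-- The round in which entry `i` of a row is decided. -/
def keyAt (m : ℕ → ℕ) (i : ℕ) : ℕ := if i < m 0 then i else m 0 + rankAt m (i - m 0)

/-- Write the extension of row `j` in round `t` into the first free row. -/
def writeRow (m : ℕ → ℕ) (t j : ℕ) : ℕ → ℕ :=
  foldUpTo (fun m i => Function.update m (rowAddr m (m 1) + i)
    (if keyAt m i = t then 1 else m (rowAddr m j + i))) m (m 0 + m 0)

open Classical in
/-- Keep the row that has been written unless its signature is present. -/
noncomputable def keepRow (m : ℕ → ℕ) (t : ℕ) : ℕ → ℕ :=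
  if ∃ p < m 1, SameSignatureAt m (t + 1 - m 0) p (m 1) then m
  else Function.update m 1 (m 1 + 1)

/-- Round `t` of the search. -/
noncomputable def searchRound (m : ℕ → ℕ) (t : ℕ) : ℕ → ℕ :=
  foldUpTo (fun m j => keepRow (writeRow m t j) t) m (m 1)

/-- The search for partial solutions of all signatures. -/
noncomputable def search (m : ℕ → ℕ) : ℕ → ℕ :=
  foldUpTo (fun m t => searchRound m t) m (m 0 + m 0)

section Search

variable {n c : ℕ} {G : SimpleGraph (Fin n)} {color : Fin n → Fin c} {m : ℕ → ℕ}

theorem rowAddr_add_le (m : ℕ → ℕ) {j k : ℕ} (h : j < k) :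
    rowAddr m j + (m 0 + m 0) ≤ rowAddr m k := by
  have := Nat.mul_le_mul_left (m 0 + m 0) (Nat.succ_le_of_lt h)
  rw [Nat.mul_succ] at this
  unfold rowAddr
  omega

theorem rowAddr_congr {m m' : ℕ → ℕ} (h : m' 0 = m 0) (j : ℕ) : rowAddr m' j = rowAddr m j := by
  simp only [rowAddr, h]

theorem rowSets_congr {m m' : ℕ → ℕ} {j : ℕ} (h0 : m 0 = n) (h : m' 0 = m 0)
    (hm : ∀ i < m 0 + m 0, m' (rowAddr m j + i) = m (rowAddr m j + i)) :
    rowSets n m' j = rowSets n m j := by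
  subst h0
  refine Prod.ext ?_ ?_ <;> ext v <;>
    simp only [rowSets, InFst, InSnd, Set.mem_ofPred_eq, rowAddr_congr h, h]
  · rw [hm _ (by omega)]
  · rw [hm _ (by omega)]

theorem HoldsTables.le_rowAddr (h : HoldsTables G color m) (j : ℕ) :
    2 + n + n * n + n * n ≤ rowAddr m j := by
  unfold rowAddr
  rw [h.size]
  omega

theorem HoldsTables.keyAt_eq (h : HoldsTables G color m) (v : Fin n) :
    keyAt m v = v ∧ keyAt m (m 0 + v) = n + lexRank (fun v => (color v : ℕ)) v := by
  unfold keyAt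
  rw [h.size, if_pos v.2, if_neg (by omega), Nat.add_sub_cancel_left, h.rankAt_eq]
  exact ⟨rfl, rfl⟩

theorem writeRow_spec (h : HoldsTables G color m) (t : ℕ) {j : ℕ} (hj : j < m 1) :
    (∀ x, x < rowAddr m (m 1) → writeRow m t j x = m x) ∧
      rowSets n (writeRow m t j) (m 1) = extend color t (rowSets n m j) := by
  have hadd := rowAddr_add_le m hj
  have hle := h.le_rowAddr (m 1)
  have key := foldUpTo_induction (F := fun m i => Function.update m (rowAddr m (m 1) + i)
    (if keyAt m i = t then 1 else m (rowAddr m j + i))) (m := m) (N := m 0 + m 0)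
    (fun i m' => (∀ x, x < rowAddr m (m 1) → m' x = m x) ∧
      ∀ i' < i, m' (rowAddr m (m 1) + i') = if keyAt m i' = t then 1 else m (rowAddr m j + i'))
    ⟨fun _ _ => rfl, fun _ h => absurd h (by omega)⟩ (by
      rintro i hi m' ⟨h1, h2⟩
      have hh : HoldsTables G color m' := h.of_eq fun x hx hx' => h1 x (by omega)
      have e0 : m' 0 = m 0 := h1 0 (by omega)
      have e1 : m' 1 = m 1 := h1 1 (by omega)
      -- Keys depend only on the size and the colors, which the writes into the free row do not
      -- touch.
      have ek : keyAt m' i = keyAt m i := by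
        by_cases hin : i < n
        · rw [(hh.keyAt_eq ⟨i, hin⟩).1, (h.keyAt_eq ⟨i, hin⟩).1]
        · have hs := h.size
          have a1 := (hh.keyAt_eq ⟨i - n, by omega⟩).2
          have a2 := (h.keyAt_eq ⟨i - n, by omega⟩).2
          rw [e0] at a1
          simp only [hs, show n + (i - n) = i by omega] at a1 a2
          rw [a1, a2]
      refine ⟨fun x hx => ?_, fun i' hi' => ?_⟩
      · rw [Function.update_of_ne, h1 x hx]
        rw [rowAddr_congr e0, e1]
        omega
      · rw [rowAddr_congr e0, rowAddr_congr e0, e1, ek]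
        by_cases e : i' = i
        · rw [e, Function.update_self, h1 (rowAddr m j + i) (by omega)]
        · rw [Function.update_of_ne (by omega), h2 i' (by omega)]) (m 0 + m 0) le_rfl
  obtain ⟨h1, h2⟩ := key
  refine ⟨h1, ?_⟩
  have e0 : writeRow m t j 0 = m 0 := h1 0 (by omega)
  have hs := h.size
  change ∀ i' < m 0 + m 0, writeRow m t j (rowAddr m (m 1) + i') = _ at h2
  refine Prod.ext ?_ ?_ <;> ext v <;>
    simp only [rowSets, InFst, InSnd, Set.mem_ofPred_eq, rowAddr_congr e0, e0, extend,
      Set.mem_union]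
  · rw [h2 _ (by omega), (h.keyAt_eq v).1]
    split_ifs with hv <;> simp [hv]
  · rw [h2 _ (by omega), (h.keyAt_eq v).2]
    split_ifs with hv <;> simp [hv]

/-- The effect of the treatment of row `j` in round `t`. -/
theorem keepRow_writeRow_spec (h : HoldsTables G color m) (t : ℕ) {j : ℕ} (hj : j < m 1) :
    ∃ m', keepRow (writeRow m t j) t = m' ∧ HoldsTables G color m' ∧
      (∀ p < m 1, rowSets n m' p = rowSets n m p) ∧
      ((m' 1 = m 1 ∧ ∃ p < m 1, roundSignature G color (t + 1) (rowSets n m p) =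
          roundSignature G color (t + 1) (extend color t (rowSets n m j))) ∨
        (m' 1 = m 1 + 1 ∧ rowSets n m' (m 1) = extend color t (rowSets n m j) ∧
          ∀ p < m 1, roundSignature G color (t + 1) (rowSets n m p) ≠
            roundSignature G color (t + 1) (extend color t (rowSets n m j)))) := by
  obtain ⟨h1, h2⟩ := writeRow_spec h t hj
  set w := writeRow m t j with hw
  have hle := h.le_rowAddr (m 1)
  have hh : HoldsTables G color w := h.of_eq fun x hx hx' => h1 x (by omega)
  have e0 : w 0 = m 0 := h1 0 (by omega)
  have e1 : w 1 = m 1 := h1 1 (by omega)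
  have hrow : ∀ p < m 1, rowSets n w p = rowSets n m p := fun p hp =>
    rowSets_congr h.size e0 fun i hi => h1 _ (by
      have := rowAddr_add_le m hp
      omega)
  have hcond : (∃ p < w 1, SameSignatureAt w (t + 1 - w 0) p (w 1)) ↔
      ∃ p < m 1, roundSignature G color (t + 1) (rowSets n m p) =
        roundSignature G color (t + 1) (extend color t (rowSets n m j)) := by
    rw [e1, hh.size]
    refine exists_congr fun p => and_congr_right fun hp => ?_
    rw [hh.sameSignatureAt_iff, hrow p hp, h2]
  refine ⟨_, rfl, ?_⟩
  unfold keepRow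
  split_ifs with hc
  -- A rejected row stays in the memory beyond the counted rows; the next write replaces all its
  -- entries.
  · exact ⟨hh, hrow, .inl ⟨e1, hcond.1 hc⟩⟩
  · have hup : ∀ p, rowSets n (Function.update w 1 (w 1 + 1)) p = rowSets n w p := fun p =>
      rowSets_congr hh.size (Function.update_of_ne (by omega) ..) fun i hi =>
        Function.update_of_ne (by have := hh.le_rowAddr p; omega) ..
    refine ⟨hh.of_eq fun x hx hx' => Function.update_of_ne hx .., fun p hp => ?_, .inr ⟨?_, ?_, ?_⟩⟩
    · rw [hup, hrow p hp]
    · rw [Function.update_self, e1]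
    · rw [hup, h2]
    · rw [hcond] at hc
      push Not at hc
      exact hc

/-- The number of signatures. -/
def signatureBound (r n : ℕ) : ℕ := 2 ^ (4 * r + 1) * (n + 1)

/-- The invariant of the rounds. -/
structure SearchInvariant (G : SimpleGraph (Fin n)) (color : Fin n → Fin c) (t : ℕ)
    (m : ℕ → ℕ) : Prop where
  tables : HoldsTables G color m
  pos : 0 < m 1
  le : m 1 ≤ 1 + t * signatureBound (neighborhoodDiversity G) n
  decided : ∀ p < m 1, DecidedBy color t (rowSets n m p)
  exhaustive : ∀ X, DecidedBy color t X →
    ∃ p < m 1, roundSignature G color t (rowSets n m p) = roundSignature G color t X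

/-- The invariant of round `t`, started in `m₀`, when `j` rows have been treated. -/
structure RoundInvariant (G : SimpleGraph (Fin n)) (color : Fin n → Fin c) (t : ℕ)
    (m₀ : ℕ → ℕ) (j : ℕ) (m : ℕ → ℕ) : Prop where
  tables : HoldsTables G color m
  le : m₀ 1 ≤ m 1
  old : ∀ p < m₀ 1, rowSets n m p = rowSets n m₀ p
  decided : ∀ p < m 1, DecidedBy color (t + 1) (rowSets n m p)
  treated : ∀ i < j, ∃ p < m 1, roundSignature G color (t + 1) (rowSets n m p) =
    roundSignature G color (t + 1) (extend color t (rowSets n m₀ i))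
  distinct : ∀ p q, m₀ 1 ≤ p → p < q → q < m 1 →
    roundSignature G color (t + 1) (rowSets n m p) ≠ roundSignature G color (t + 1) (rowSets n m q)

/-- Only the rows created in the current round are known to have distinct signatures; older ones may
have become equivalent. Hence the bound on the number of rows grows additively with the rounds. -/
theorem RoundInvariant.le_add {t j : ℕ} {m₀ : ℕ → ℕ} (h : RoundInvariant G color t m₀ j m) :
    m 1 ≤ m₀ 1 + signatureBound (neighborhoodDiversity G) n := by
  have h1 := card_le_of_injOn_signature (τ := Quotient.mk (typeSetoid G)) (δ := distUpTo G n)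
    (col := fun v => (color v : ℕ)) (rank := lexRank fun v => (color v : ℕ))
    (Finset.Ico (m₀ 1) (m 1)) (t + 1 - n)
    (fun p => (rowSets n m p).1) (fun p => (rowSets n m p).2) (by
      intro p hp q hq e
      rw [Finset.coe_Ico, Set.mem_Ico] at hp hq
      rcases lt_trichotomy p q with hlt | heq | hlt
      · exact absurd e (h.distinct p q hp.1 hlt hq.2)
      · exact heq
      · exact absurd e.symm (h.distinct q p hq.1 hlt hp.2))
  rw [Nat.card_Ico, Nat.card_fin] at h1
  have h2 : 2 ^ (4 * Nat.card (Quotient (typeSetoid G)) + 1) * (n + 1) ≤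
      signatureBound (neighborhoodDiversity G) n :=
    Nat.mul_le_mul_right _ (Nat.pow_le_pow_right (by omega) (by
      have := card_types_le (G := G)
      omega))
  omega

theorem SearchInvariant.roundInvariant {t : ℕ} (h : SearchInvariant G color t m) :
    ∀ j ≤ m 1, RoundInvariant G color t m j
      (foldUpTo (fun m j => keepRow (writeRow m t j) t) m j) := by
  refine foldUpTo_induction (RoundInvariant G color t m) ?_ ?_
  · exact ⟨h.tables, le_rfl, fun _ _ => rfl, fun p hp => (h.decided p hp).mono (by omega),
      fun i hi => absurd hi (by omega), fun p q h1 h2 h3 => absurd h3 (by omega)⟩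
  · intro j hj a ha
    obtain ⟨b, rfl, hb, hrow, hcase⟩ := keepRow_writeRow_spec ha.tables t (hj.trans_le ha.le)
    set b := keepRow (writeRow a t j) t
    rw [ha.old j hj] at hcase
    have hle : a 1 ≤ b 1 := by
      obtain ⟨e, -⟩ | ⟨e, -⟩ := hcase <;> omega
    have hnew : ∀ p < b 1, a 1 ≤ p → p = a 1 ∧ b 1 = a 1 + 1 ∧
        rowSets n b p = extend color t (rowSets n m j) ∧
        ∀ q < a 1, roundSignature G color (t + 1) (rowSets n a q) ≠
          roundSignature G color (t + 1) (extend color t (rowSets n m j)) := by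
      intro p hp hap
      obtain ⟨e, -⟩ | ⟨e, e', h'⟩ := hcase
      · omega
      · obtain rfl : p = a 1 := by omega
        exact ⟨rfl, e, e', h'⟩
    refine ⟨hb, ha.le.trans hle, fun p hp => ?_, fun p hp => ?_, fun i hi => ?_,
      fun p q h1 h2 h3 => ?_⟩
    · rw [hrow p (hp.trans_le ha.le), ha.old p hp]
    · by_cases hpa : p < a 1
      · rw [hrow p hpa]
        exact ha.decided p hpa
      · rw [(hnew p hp (by omega)).2.2.1]
        exact (h.decided j hj).extend
    · by_cases hij : i = j
      · subst hij
        obtain ⟨e, p, hp, e'⟩ | ⟨e, e', -⟩ := hcase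
        · exact ⟨p, hp.trans_le hle, by rw [hrow p hp, e']⟩
        · exact ⟨a 1, by omega, by rw [e']⟩
      · obtain ⟨p, hp, e⟩ := ha.treated i (by omega)
        exact ⟨p, hp.trans_le hle, by rw [hrow p hp, e]⟩
    · by_cases hqa : q < a 1
      · rw [hrow q hqa, hrow p (h2.trans hqa)]
        exact ha.distinct p q h1 h2 hqa
      · obtain ⟨e1, -, e2, e3⟩ := hnew q h3 (by omega)
        rw [e2, hrow p (by omega)]
        exact e3 p (by omega)

/-- A pair decided after round `t` is an earlier pair or its extension. The first is represented by
an old row, the second by the row produced from its representative, both by the congruence property.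
-/
theorem SearchInvariant.searchRound {t : ℕ} (h : SearchInvariant G color t m) :
    SearchInvariant G color (t + 1) (searchRound m t) := by
  have hr := h.roundInvariant (m 1) le_rfl
  refine ⟨hr.tables, h.pos.trans_le hr.le, ?_, hr.decided, fun X hX => ?_⟩
  · have h1 := hr.le_add
    have h2 := h.le
    rw [add_mul, one_mul]
    exact h1.trans (by omega)
  · obtain hX | ⟨Y, hY, rfl⟩ := hX.eq_extend
    · obtain ⟨p, hp, e⟩ := h.exhaustive X hX
      refine ⟨p, hp.trans_le hr.le, ?_⟩
      show roundSignature G color (t + 1) (rowSets n (foldUpTo _ m (m 1)) p) = _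
      rw [hr.old p hp]
      exact roundSignature_succ (h.decided p hp) hX e
    · obtain ⟨p, hp, e⟩ := h.exhaustive Y hY
      obtain ⟨q, hq, e'⟩ := hr.treated p hp
      exact ⟨q, hq, e'.trans (roundSignature_extend (h.decided p hp) hY e)⟩

theorem SearchInvariant.search (h : SearchInvariant G color 0 m) :
    ∀ t ≤ m 0 + m 0, SearchInvariant G color t (foldUpTo (fun m t => _root_.searchRound m t) m t) :=
  foldUpTo_induction (SearchInvariant G color) h fun _ _ _ ha => ha.searchRound

/-- After the search, a minimum consistent subset is among the rows. -/
theorem SearchInvariant.exists_row (h : SearchInvariant G color (n + n) m)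
    {U : Set (Fin n)} (hU : IsConsistentSubset G color U) :
    ∃ p < m 1, IsConsistentSubset G color (rowSets n m p).2 ∧ (rowSets n m p).2.ncard = U.ncard := by
  -- The guess that belongs to the solution `U` is `U` itself.
  obtain ⟨p, hp, e⟩ := h.exhaustive (U, U) ⟨fun v _ => by have := v.2; show (v : ℕ) < n + n; omega,
    fun v _ => by have := lexRank_lt_card (fun v => (color v : ℕ)) v; omega⟩
  have hU' := (isConsistentSubset_iff color U).1 hU
  obtain ⟨h1, h2⟩ := exists_near_of_signature_eq (distUpTo_twin n) (fun v w => by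
      rw [distUpTo_le_iff, SimpleGraph.edist_self]; exact zero_le)
    (fun w => by rw [Nat.add_sub_cancel]; exact lexRank_lt_card _ w) (distUpTo_symm n)
    (fun w => by
      obtain ⟨y, hy, e, hz⟩ := hU' w
      exact ⟨y, hy, congrArg Fin.val e, hz⟩) e
  refine ⟨p, hp, (isConsistentSubset_iff color _).2 fun w => ?_, h2⟩
  obtain ⟨y, hy, e, hz⟩ := h1 w
  exact ⟨y, hy, Fin.ext e, hz⟩

end Search

/-! ## The distance table -/

/-- Fill the table row by row. -/
def fillTable (val : (ℕ → ℕ) → ℕ → ℕ → ℕ) (m : ℕ → ℕ) : ℕ → ℕ :=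
  foldUpTo (fun m u => foldUpTo (fun m v => Function.update m (distAddr m u v) (val m u v)) m (m 0))
    m (m 0)

open Classical in
/-- The entries of the distance table that are computed in round `k` of a breadth first search. -/
noncomputable def bfsEntry (k : ℕ) (m : ℕ → ℕ) (u v : ℕ) : ℕ :=
  if distAt m u v = m 0 ∧ ∃ w < m 0, distAt m u w = k ∧ adjAt m w v ≠ 0 then k + 1
  else distAt m u v

/-- Compute the distance table. -/
noncomputable def bfs (m : ℕ → ℕ) : ℕ → ℕ :=
  foldUpTo (fun m k => fillTable (bfsEntry k) m)
    (fillTable (fun m u v => if u = v then 0 else m 0) m) (m 0)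

section Tables

variable {n c : ℕ} {G : SimpleGraph (Fin n)} {color : Fin n → Fin c} {m : ℕ → ℕ}

/-- The table is updated in place, so an entry is computed from a mixture of old and new entries;
`hval` asks that this mixture does not affect the result. -/
theorem fillTable_spec {val : (ℕ → ℕ) → ℕ → ℕ → ℕ} (h : HoldsInput G color m)
    (old new : ℕ → ℕ → ℕ)
    (hold : ∀ u < n, ∀ v < n, distAt m u v = old u v)
    (hval : ∀ m', HoldsInput G color m' →
      (∀ u < n, ∀ v < n, distAt m' u v = old u v ∨ distAt m' u v = new u v) →
      ∀ u < n, ∀ v < n, distAt m' u v = old u v → val m' u v = new u v) :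
    (∀ x, x < 2 + n + n * n ∨ 2 + n + n * n + n * n ≤ x → fillTable val m x = m x) ∧
      ∀ u < n, ∀ v < n, distAt (fillTable val m) u v = new u v := by
  let J : ℕ → ℕ → (ℕ → ℕ) → Prop := fun u v m' =>
    (∀ x, x < 2 + n + n * n ∨ 2 + n + n * n + n * n ≤ x → m' x = m x) ∧
      ∀ u' < n, ∀ v' < n, distAt m' u' v' =
        if u' < u ∨ (u' = u ∧ v' < v) then new u' v' else old u' v'
  have hstep : ∀ u < n, ∀ v < n, ∀ m', J u v m' →
      J u (v + 1) (Function.update m' (distAddr m' u v) (val m' u v)) := by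
    rintro u hu v hv m' ⟨h1, h2⟩
    have hm' : HoldsInput G color m' := h.of_eq fun x _ hx => h1 x (.inl hx)
    have hsize := hm'.size
    have hlt := table_index_lt hu hv
    have hv' : val m' u v = new u v := by
      refine hval m' hm' (fun u' hu' v' hv' => ?_) u hu v hv ?_
      · rw [h2 u' hu' v' hv']
        split_ifs <;> simp
      · rw [h2 u hu v hv, if_neg (by omega)]
    have ha : distAddr m' u v = 2 + n + n * n + (n * u + v) := by rw [distAddr, hsize]
    refine ⟨fun x hx => ?_, fun u' hu' v' hv' => ?_⟩
    · rw [Function.update_of_ne (by omega), h1 x hx]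
    · have h0 : Function.update m' (distAddr m' u v) (val m' u v) 0 = n := by
        rw [Function.update_of_ne (by omega), hsize]
      have := h2 u' hu' v' hv'
      rw [distAt, distAddr, hsize] at this
      have ha' : distAddr (Function.update m' (distAddr m' u v) (val m' u v)) u' v' =
          2 + n + n * n + (n * u' + v') := by rw [distAddr, h0]
      rw [distAt, ha', ha]
      by_cases e : u' = u ∧ v' = v
      · obtain ⟨rfl, rfl⟩ := e
        rw [Function.update_self, if_pos (by omega), ‹val m' u' v' = new u' v'›]
      · rw [Function.update_of_ne, this]
        · congr 1
          simp only [eq_iff_iff]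
          omega
        · rw [← table_index_inj hv' hv] at e
          omega
  have hs := h.size
  have hrow : ∀ u < n, ∀ m', J u 0 m' →
      J (u + 1) 0 (foldUpTo (fun m v => Function.update m (distAddr m u v) (val m u v)) m' (m' 0)) := by
    intro u hu m' hJ
    have e0 : m' 0 = n := by rw [hJ.1 0 (by omega), hs]
    rw [e0]
    obtain ⟨h1, h2⟩ := foldUpTo_induction (J u) hJ (fun v hv a ha => hstep u hu v hv a ha) n le_rfl
    refine ⟨h1, fun u' hu' v' hv' => ?_⟩
    rw [h2 u' hu' v' hv']
    congr 1
    simp only [eq_iff_iff]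
    omega
  obtain ⟨h1, h2⟩ := foldUpTo_induction
    (F := fun m u => foldUpTo (fun m v => Function.update m (distAddr m u v) (val m u v)) m (m 0))
    (fun u m' => J u 0 m') (m := m) (N := n)
    ⟨fun _ _ => rfl, fun u hu v hv => by rw [hold u hu v hv, if_neg (by omega)]⟩
    (fun u hu a ha => hrow u hu a ha) n le_rfl
  unfold fillTable
  rw [hs]
  exact ⟨h1, fun u hu v hv => by rw [h2 u hu v hv, if_pos (.inl hu)]⟩

variable (G) in
/-- `distUpTo` as a function of natural numbers. -/
noncomputable def natDistUpTo (k u v : ℕ) : ℕ :=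
  if h : u < n ∧ v < n then distUpTo G k ⟨u, h.1⟩ ⟨v, h.2⟩ else 0

theorem natDistUpTo_fin (k : ℕ) (u v : Fin n) : natDistUpTo G k u v = distUpTo G k u v := by
  simp [natDistUpTo]

theorem natDistUpTo_mk (k : ℕ) {u v : ℕ} (hu : u < n) (hv : v < n) :
    natDistUpTo G k u v = distUpTo G k ⟨u, hu⟩ ⟨v, hv⟩ :=
  natDistUpTo_fin k ⟨u, hu⟩ ⟨v, hv⟩

theorem bfs_spec (h : HoldsInput G color m) : HoldsTables G color (bfs m) ∧
    ∀ x, x < 2 + n + n * n ∨ 2 + n + n * n + n * n ≤ x → bfs m x = m x := by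
  have hinit := fillTable_spec h (val := fun m u v => if u = v then 0 else m 0)
    (fun u v => distAt m u v) (natDistUpTo G 0) (fun _ _ _ _ => rfl) (by
      intro m' hm' _ u hu v hv _
      rw [natDistUpTo_mk 0 hu hv, distUpTo_zero, hm'.size]
      simp only [Fin.mk.injEq])
  have key := foldUpTo_induction (F := fun m k => fillTable (bfsEntry k) m)
    (m := fillTable (fun m u v => if u = v then 0 else m 0) m) (N := n)
    (fun k m' => (∀ x, x < 2 + n + n * n ∨ 2 + n + n * n + n * n ≤ x → m' x = m x) ∧
      ∀ u < n, ∀ v < n, distAt m' u v = natDistUpTo G k u v) hinit (by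
      rintro k hk a ⟨h1, h2⟩
      have ha : HoldsInput G color a := h.of_eq fun x _ hx => h1 x (.inl hx)
      obtain ⟨h3, h4⟩ := fillTable_spec ha (val := bfsEntry k) (natDistUpTo G k)
        (natDistUpTo G (k + 1)) h2 (by
          intro m' hm' hor u hu v hv huv
          classical
          rw [natDistUpTo_mk (k + 1) hu hv, distUpTo_succ hk, bfsEntry, huv, hm'.size,
            natDistUpTo_mk k hu hv]
          congr 1
          rw [eq_iff_iff]
          refine and_congr_right fun _ => ?_
          rw [exists_lt_iff_fin]
          refine exists_congr fun w => ?_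
          have hadj : adjAt m' w v ≠ 0 ↔ G.Adj w ⟨v, hv⟩ := by
            rw [adjAt, hm'.size]
            exact hm'.adj w ⟨v, hv⟩
          rw [hadj]
          refine and_congr_left fun _ => ?_
          have e1 := natDistUpTo_mk (G := G) k hu w.2
          have e2 := natDistUpTo_mk (G := G) (k + 1) hu w.2
          -- Old and new entries agree on being equal to `k`, since round `k` only introduces the
          -- value `k + 1`.
          obtain e' | e' := hor u hu w w.2
          · rw [e', e1]
          · rw [e', e2, distUpTo_eq hk, distUpTo_eq hk]
            simp)
      exact ⟨fun x hx => by rw [h3 x hx, h1 x hx], h4⟩) n le_rfl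
  obtain ⟨h1, h2⟩ := key
  unfold bfs
  rw [h.size]
  refine ⟨⟨h.of_eq fun x _ hx => h1 x (.inl hx), fun u v => ?_⟩, h1⟩
  have := h2 u u.2 v v.2
  rwa [natDistUpTo_fin, distAt, distAddr, h1 0 (by omega), h.size] at this

/-- The row area is still zero, so row `0` is the empty pair, the only pair decided before the first
round. -/
theorem searchInvariant_bfs (h : HoldsInput G color m) (h1 : m 1 = 1)
    (hzero : ∀ x, 2 + n + n * n ≤ x → m x = 0) : SearchInvariant G color 0 (bfs m) := by
  obtain ⟨ht, hm⟩ := bfs_spec h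
  have e1 : bfs m 1 = 1 := by rw [hm 1 (by omega), h1]
  have hrow : rowSets n (bfs m) 0 = (∅, ∅) := by
    have hle := ht.le_rowAddr 0
    refine Prod.ext ?_ ?_ <;> ext v <;>
      simp only [rowSets, InFst, InSnd, Set.mem_ofPred_eq, Set.mem_empty_iff_false, iff_false,
        not_not]
    · rw [hm _ (by omega), hzero _ (by omega)]
    · rw [hm _ (by omega), hzero _ (by omega)]
  have hp : ∀ p < bfs m 1, rowSets n (bfs m) p = (∅, ∅) := by
    intro p hp
    obtain rfl : p = 0 := by omega
    exact hrow
  refine ⟨ht, by omega, by omega, fun p hlt => ?_, fun X hX => ⟨0, by omega, ?_⟩⟩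
  · rw [hp p hlt]
    exact ⟨fun v hv => absurd hv (by simp), fun v hv => absurd hv (by simp)⟩
  · rw [hrow]
    congr 1
    refine Prod.ext ?_ ?_ <;> ext v <;> simp only [Set.mem_empty_iff_false, false_iff]
    · exact fun hv => absurd (hX.1 v hv) (by omega)
    · exact fun hv => absurd (hX.2 v hv) (by omega)

end Tables

/-! ## The encoding of the input -/

theorem getElem?_flatMap_of_length {α β : Type*} {n : ℕ} (l : List α) (g : α → List β)
    (hg : ∀ a ∈ l, (g a).length = n) {i v : ℕ} (hi : i < l.length) (hv : v < n) :
    (l.flatMap g)[n * i + v]? = (g l[i])[v]? := by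
  induction l generalizing i with
  | nil => simp at hi
  | cons a l ih =>
    have ha := hg a (by simp)
    rw [List.flatMap_cons]
    cases i with
    | zero => simp [List.getElem?_append, ha, hv]
    | succ i =>
      rw [List.getElem?_append_right (by rw [ha, Nat.mul_succ]; omega), ha,
        show n * (i + 1) + v - n = n * i + v by rw [Nat.mul_succ]; omega]
      simpa using ih (fun b hb => hg b (by simp [hb])) (by simpa using hi)

theorem holdsInput_init {n c : ℕ} (G : SimpleGraph (Fin n)) (color : Fin n → Fin c) :
    HoldsInput G color (RamState.init (encodeColoredGraph G color)).mem ∧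
      ∀ x, 2 + n + n * n ≤ x → (RamState.init (encodeColoredGraph G color)).mem x = 0 := by
  classical
  refine ⟨⟨rfl, fun v => ?_, fun u v => ?_⟩, fun x hx => ?_⟩
  · simp only [RamState.init, encodeColoredGraph, List.getD_eq_getElem?_getD]
    rw [List.getElem?_append_left (by simp; omega), List.getElem?_append_right (by simp)]
    simp
  · simp only [RamState.init, encodeColoredGraph, List.getD_eq_getElem?_getD]
    rw [List.getElem?_append_right (by simp; omega)]
    simp only [List.length_append, List.length_cons, List.length_nil, List.length_map,
      List.length_finRange]
    rw [show 2 + n + (n * u + v) - (0 + 1 + 1 + n) = n * u + v by omega,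
      getElem?_flatMap_of_length (n := n) _ _ (by simp) (by simp) v.2]
    simp
  · simp only [RamState.init, encodeColoredGraph]
    rw [List.getD_eq_default]
    simp only [List.length_append, List.length_cons, List.length_nil, List.length_map,
      List.length_finRange, List.length_flatMap, List.map_const', List.sum_replicate, smul_eq_mul]
    omega

/-! ## The output -/

open Classical in
/-- The index of the first best row. -/
noncomputable def bestIndex (m : ℕ → ℕ) : ℕ :=
  ∑ j ∈ Finset.range (m 1), if ∃ i < m 1, i ≤ j ∧ BestAt m i then 0 else 1

/-- Copy `N` truth values from address `a` on to the start of the memory. -/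
def copyOut (m : ℕ → ℕ) (a N : ℕ) : ℕ → ℕ :=
  foldUpTo (fun m v => Function.update m v (if m (a + v) = 0 then 0 else 1)) m N

/-- Write the second set of the first best row to the start of the memory. -/
noncomputable def writeBest (m : ℕ → ℕ) : ℕ → ℕ :=
  copyOut m (rowAddr m (bestIndex m) + m 0) (m 0)

/-- The sum counts the indices `j` with no best row up to `j`, which are those before the first best
row. -/
theorem bestIndex_spec {m : ℕ → ℕ} (h : ∃ j < m 1, BestAt m j) :
    bestIndex m < m 1 ∧ BestAt m (bestIndex m) := by
  classical
  have key : bestIndex m = Nat.find h := by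
    have hlt := (Nat.find_spec h).1
    have : ∀ j ∈ Finset.range (m 1), (if ∃ i < m 1, i ≤ j ∧ BestAt m i then 0 else 1) =
        if j < Nat.find h then 1 else 0 := by
      intro j _
      by_cases hj : j < Nat.find h
      · rw [if_pos hj, if_neg]
        rintro ⟨i, hi, hij, hb⟩
        exact Nat.find_min h (hij.trans_lt hj) ⟨hi, hb⟩
      · rw [if_neg hj, if_pos ⟨Nat.find h, hlt, by omega, (Nat.find_spec h).2⟩]
    rw [bestIndex, Finset.sum_congr rfl this, ← Finset.card_filter,
      show (Finset.range (m 1)).filter (· < Nat.find h) = Finset.range (Nat.find h) by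
        ext j; simp only [Finset.mem_filter, Finset.mem_range]; omega, Finset.card_range]
  rw [key]
  exact Nat.find_spec h

/-- Source and target may overlap, but copying upwards reads cell `a + v` before any write can reach
it. -/
theorem copyOut_spec (m : ℕ → ℕ) {a N v : ℕ} (hv : v < N) :
    copyOut m a N v = if m (a + v) = 0 then 0 else 1 := by
  have := foldUpTo_induction
    (F := fun m v => Function.update m v (if m (a + v) = 0 then 0 else 1)) (m := m) (N := N)
    (fun i m' => (∀ x, i ≤ x → m' x = m x) ∧ ∀ v < i, m' v = if m (a + v) = 0 then 0 else 1)
    ⟨fun _ _ => rfl, fun _ h => absurd h (by omega)⟩ (by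
      rintro i hi m' ⟨h1, h2⟩
      refine ⟨fun x hx => by rw [Function.update_of_ne (by omega), h1 x (by omega)], fun v hv => ?_⟩
      by_cases e : v = i
      · rw [e, Function.update_self, h1 _ (by omega)]
      · rw [Function.update_of_ne e, h2 v (by omega)]) N le_rfl
  exact this.2 v hv

theorem isConsistentSubset_univ {n : ℕ} {κ : Type*} (G : SimpleGraph (Fin n))
    (color : Fin n → κ) : IsConsistentSubset G color Set.univ :=
  (isConsistentSubset_iff color _).2 fun w => ⟨w, trivial, rfl, fun z _ => by
    rw [distUpTo_le_iff, SimpleGraph.edist_self]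
    exact zero_le⟩

/-- Every consistent subset is matched by a consistent row of the same size, so a smallest
consistent row is optimal among all subsets; the full vertex set shows that consistent rows exist.
-/
theorem SearchInvariant.writeBest_spec {n c : ℕ} {G : SimpleGraph (Fin n)} {color : Fin n → Fin c}
    {m : ℕ → ℕ} (h : SearchInvariant G color (n + n) m) :
    ∃ S : Finset (Fin n), IsMinConsistentSubset G color S ∧
      ∀ v : Fin n, writeBest m v = if v ∈ S then 1 else 0 := by
  classical
  have hex : ∃ j < m 1, BestAt m j := by
    obtain ⟨p, hp, hc, -⟩ := h.exists_row (isConsistentSubset_univ G color)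
    rw [← h.tables.consistentAt_iff] at hc
    obtain ⟨j, hj, hmin⟩ := Finset.exists_min_image
      ((Finset.range (m 1)).filter fun j => ConsistentAt m j) (sizeAt m) ⟨p, by simp [hp, hc]⟩
    simp only [Finset.mem_filter, Finset.mem_range] at hj hmin
    exact ⟨j, hj.1, hj.2, fun i hi hci => hmin i ⟨hi, hci⟩⟩
  obtain ⟨hlt, hc, hmin⟩ := bestIndex_spec hex
  rw [h.tables.consistentAt_iff] at hc
  refine ⟨(rowSets n m (bestIndex m)).2.toFinset, ⟨by simpa using hc, fun S' hS' => ?_⟩,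
    fun v => ?_⟩
  · obtain ⟨p, hp, hcp, e⟩ := h.exists_row hS'
    have := hmin p hp ((h.tables.consistentAt_iff p).2 hcp)
    rw [h.tables.sizeAt_eq, h.tables.sizeAt_eq, e, Set.ncard_coe_finset] at this
    rwa [← Set.ncard_eq_toFinset_card']
  · have hle := h.tables.le_rowAddr (bestIndex m)
    have hs := h.tables.size
    rw [writeBest, copyOut_spec m (by rw [hs]; exact v.2)]
    have hmem : v ∈ (rowSets n m (bestIndex m)).2.toFinset ↔
        m (rowAddr m (bestIndex m) + m 0 + v) ≠ 0 := by
      rw [Set.mem_toFinset, add_assoc]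
      rfl
    simp only [hmem, ne_eq, ite_not]

/-! ## Programs -/

section Programs

/-- The numbers of vertices and of rows are bounded by `L`. -/
def SizesLe {Γ : Type} (m : ℕ → ℕ) (_ : Γ) (L : ℕ) : Prop := m 0 + m 0 ≤ L ∧ m 1 ≤ L

variable {Γ : Type} [RegContext Γ]

theorem realizes_size {V : (ℕ → ℕ) → Γ → ℕ → Prop} : RealizesExpr V fun m _ => m 0 :=
  (RealizesExpr.const 0).load

theorem realizes_rows {V : (ℕ → ℕ) → Γ → ℕ → Prop} : RealizesExpr V fun m _ => m 1 :=
  (RealizesExpr.const 1).load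

omit [RegContext Γ] in
theorem SizesLe.size_le (m : ℕ → ℕ) (γ : Γ) (L : ℕ) (h : SizesLe m γ L) : m 0 ≤ L :=
  le_of_add_le_left h.1

theorem RealizesExpr.sumSize {f : (ℕ → ℕ) → Γ → ℕ → ℕ}
    (hf : RealizesExpr (Γ := Γ × ℕ) SizesLe (fun m p => f m p.1 p.2)) :
    RealizesExpr SizesLe fun m γ => ∑ i ∈ Finset.range (m 0), f m γ i :=
  .sum realizes_size SizesLe.size_le hf

theorem RealizesProp.allSize {P : (ℕ → ℕ) → Γ → ℕ → Prop}
    (hP : RealizesProp (Γ := Γ × ℕ) SizesLe (fun m p => P m p.1 p.2)) :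
    RealizesProp SizesLe fun m γ => ∀ i < m 0, P m γ i :=
  .all realizes_size SizesLe.size_le hP

theorem RealizesProp.exSize {P : (ℕ → ℕ) → Γ → ℕ → Prop}
    (hP : RealizesProp (Γ := Γ × ℕ) SizesLe (fun m p => P m p.1 p.2)) :
    RealizesProp SizesLe fun m γ => ∃ i < m 0, P m γ i :=
  .ex realizes_size SizesLe.size_le hP

theorem SizesLe.weaken {f : (ℕ → ℕ) → Γ → ℕ} (hf : RealizesExpr SizesLe f) :
    RealizesExpr (Γ := Γ × ℕ) SizesLe fun m p => f m p.1 :=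
  Realizes.weaken hf

theorem realizes_var0 : RealizesExpr (Γ := Γ × ℕ) SizesLe fun _ p => p.2 := .snd

theorem realizes_var1 : RealizesExpr (Γ := (Γ × ℕ) × ℕ) SizesLe fun _ p => p.1.2 :=
  SizesLe.weaken realizes_var0

theorem realizes_var2 : RealizesExpr (Γ := ((Γ × ℕ) × ℕ) × ℕ) SizesLe fun _ p => p.1.1.2 :=
  SizesLe.weaken realizes_var1

variable {f g k : (ℕ → ℕ) → Γ → ℕ} (hf : RealizesExpr SizesLe f) (hg : RealizesExpr SizesLe g)
  (hk : RealizesExpr SizesLe k)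

theorem RealizesExpr.sizeMul (hf : RealizesExpr SizesLe f) :
    RealizesExpr SizesLe fun m γ => m 0 * f m γ :=
  .mul realizes_size hf SizesLe.size_le

include hf

theorem realizes_colorAt : RealizesExpr SizesLe fun m γ => colorAt m (f m γ) :=
  ((RealizesExpr.const 2).add hf).load

theorem realizes_rowAddr : RealizesExpr SizesLe fun m γ => rowAddr m (f m γ) :=
  ((((RealizesExpr.const 2).add realizes_size).add (.sizeMul realizes_size)).add
    (.sizeMul realizes_size)).add
    (.mul (realizes_size.add realizes_size) hf fun _ _ _ h => h.1)

theorem realizes_rankAt : RealizesExpr SizesLe fun m γ => rankAt m (f m γ) := by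
  refine .sumSize (f := fun m γ w => if colorAt m w < colorAt m (f m γ) ∨
    (colorAt m w = colorAt m (f m γ) ∧ w < f m γ) then 1 else 0) (.ite ?_ (.const 1) (.const 0))
  have h1 := realizes_colorAt (Γ := Γ × ℕ) realizes_var0
  have h2 := realizes_colorAt (SizesLe.weaken hf)
  exact (RealizesProp.lt h1 h2).or ((RealizesProp.eq h1 h2).and
    (.lt realizes_var0 (SizesLe.weaken hf)))

theorem realizes_keyAt : RealizesExpr SizesLe fun m γ => keyAt m (f m γ) :=
  .ite (.lt hf realizes_size) hf
    (realizes_size.add (realizes_rankAt (hf.sub realizes_size)))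

include hg

theorem realizes_adjAt : RealizesExpr SizesLe fun m γ => adjAt m (f m γ) (g m γ) :=
  (((RealizesExpr.const 2).add realizes_size).add ((RealizesExpr.sizeMul hf).add hg)).load

theorem realizes_distAddr : RealizesExpr SizesLe fun m γ => distAddr m (f m γ) (g m γ) :=
  (((RealizesExpr.const 2).add realizes_size).add (.sizeMul realizes_size)).add
    ((RealizesExpr.sizeMul hf).add hg)

theorem realizes_distAt : RealizesExpr SizesLe fun m γ => distAt m (f m γ) (g m γ) :=
  (realizes_distAddr hf hg).load

theorem realizes_inFst : RealizesProp SizesLe fun m γ => InFst m (f m γ) (g m γ) :=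
  .ne_zero ((realizes_rowAddr hf).add hg).load

theorem realizes_inSnd : RealizesProp SizesLe fun m γ => InSnd m (f m γ) (g m γ) :=
  .ne_zero ((realizes_rowAddr hf).add (realizes_size.add hg)).load

theorem realizes_sameTypeAt : RealizesProp SizesLe fun m γ => SameTypeAt m (f m γ) (g m γ) := by
  refine .allSize (P := fun m γ z => z ≠ f m γ → z ≠ g m γ →
    (adjAt m (f m γ) z ≠ 0 ↔ adjAt m (g m γ) z ≠ 0)) ?_
  have hf' := SizesLe.weaken hf
  have hg' := SizesLe.weaken hg
  exact (RealizesProp.eq realizes_var0 hf').not.imp ((RealizesProp.eq realizes_var0 hg').not.imp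
    ((RealizesProp.ne_zero (realizes_adjAt hf' realizes_var0)).iff
      (.ne_zero (realizes_adjAt hg' realizes_var0))))

theorem realizes_finishedAt : RealizesProp SizesLe fun m γ => FinishedAt m (f m γ) (g m γ) := by
  refine .allSize (P := fun m γ y => colorAt m y = colorAt m (g m γ) → rankAt m y < f m γ) ?_
  exact (RealizesProp.eq (realizes_colorAt realizes_var0)
    (realizes_colorAt (SizesLe.weaken hg))).imp
    (.lt (realizes_rankAt realizes_var0) (SizesLe.weaken hf))

theorem realizes_currentAt : RealizesProp SizesLe fun m γ => CurrentAt m (f m γ) (g m γ) :=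
  (RealizesProp.lt (realizes_rankAt hg) hf).and (realizes_finishedAt hf hg).not

theorem realizes_servedAt : RealizesProp SizesLe fun m γ => ServedAt m (f m γ) (g m γ) := by
  refine (realizes_inSnd hf hg).or (.exSize (P := fun m γ y => InSnd m (f m γ) y ∧
    colorAt m y = colorAt m (g m γ) ∧ ∀ z < m 0, z ≠ g m γ →
      (∃ x < m 0, InFst m (f m γ) x ∧ SameTypeAt m x z) →
        distAt m (g m γ) y ≤ distAt m (g m γ) z) ?_)
  have hf1 := SizesLe.weaken hf
  have hg1 := SizesLe.weaken hg
  have hf2 := SizesLe.weaken hf1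
  have hg2 := SizesLe.weaken hg1
  have hf3 := SizesLe.weaken hf2
  refine (realizes_inSnd hf1 realizes_var0).and ((RealizesProp.eq (realizes_colorAt realizes_var0)
    (realizes_colorAt hg1)).and (.allSize (P := fun m (p : Γ × ℕ) z => z ≠ g m p.1 →
      (∃ x < m 0, InFst m (f m p.1) x ∧ SameTypeAt m x z) →
        distAt m (g m p.1) p.2 ≤ distAt m (g m p.1) z) ?_))
  refine (RealizesProp.eq realizes_var0 hg2).not.imp (.imp (.exSize (P := fun m (p : (Γ × ℕ) × ℕ) x =>
    InFst m (f m p.1.1) x ∧ SameTypeAt m x p.2) ?_)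
      (.le (realizes_distAt hg2 realizes_var1) (realizes_distAt hg2 realizes_var0)))
  exact (realizes_inFst hf3 realizes_var0).and (realizes_sameTypeAt realizes_var0 realizes_var1)

theorem realizes_allServedAt : RealizesProp SizesLe fun m γ => AllServedAt m (f m γ) (g m γ) := by
  refine .allSize (P := fun m γ w => FinishedAt m (f m γ) w → ServedAt m (g m γ) w) ?_
  exact (realizes_finishedAt (SizesLe.weaken hf) realizes_var0).imp
    (realizes_servedAt (SizesLe.weaken hg) realizes_var0)

omit hg in
theorem realizes_sizeAt : RealizesExpr SizesLe fun m γ => sizeAt m (f m γ) := by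
  classical
  refine .sumSize (f := fun m γ v => if InSnd m (f m γ) v then 1 else 0)
    (.ite ?_ (.const 1) (.const 0))
  exact realizes_inSnd (SizesLe.weaken hf) realizes_var0

omit hf hg in
theorem realizes_sameHits {A B : (ℕ → ℕ) → Γ → ℕ → Prop}
    (hA : RealizesProp (Γ := (Γ × ℕ) × ℕ) SizesLe fun m p => A m p.1.1 p.2)
    (hB : RealizesProp (Γ := (Γ × ℕ) × ℕ) SizesLe fun m p => B m p.1.1 p.2) :
    RealizesProp SizesLe fun m γ => SameHits m (A m γ) (B m γ) := by
  refine .allSize (P := fun m γ w => (∃ y < m 0, A m γ y ∧ SameTypeAt m y w) ↔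
    (∃ y < m 0, B m γ y ∧ SameTypeAt m y w)) ?_
  exact .iff
    (.exSize (P := fun m (p : Γ × ℕ) y => A m p.1 y ∧ SameTypeAt m y p.2)
      (hA.and (realizes_sameTypeAt realizes_var0 realizes_var1)))
    (.exSize (P := fun m (p : Γ × ℕ) y => B m p.1 y ∧ SameTypeAt m y p.2)
      (hB.and (realizes_sameTypeAt realizes_var0 realizes_var1)))

include hk

theorem realizes_sameSignatureAt :
    RealizesProp SizesLe fun m γ => SameSignatureAt m (k m γ) (f m γ) (g m γ) := by
  have hf2 := SizesLe.weaken (SizesLe.weaken hf)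
  have hg2 := SizesLe.weaken (SizesLe.weaken hg)
  have hk2 := SizesLe.weaken (SizesLe.weaken hk)
  have hF := realizes_inSnd hf2 realizes_var0
  have hG := realizes_inSnd hg2 realizes_var0
  have hC := realizes_currentAt hk2 realizes_var0
  exact (realizes_sameHits (A := fun m γ => InFst m (f m γ)) (B := fun m γ => InFst m (g m γ))
      (realizes_inFst hf2 realizes_var0) (realizes_inFst hg2 realizes_var0)).and <|
    (realizes_sameHits (A := fun m γ => InSnd m (f m γ)) (B := fun m γ => InSnd m (g m γ))
      hF hG).and <|
    (realizes_sameHits (A := fun m γ w => InSnd m (f m γ) w ∧ CurrentAt m (k m γ) w)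
      (B := fun m γ w => InSnd m (g m γ) w ∧ CurrentAt m (k m γ) w)
      (hF.and hC) (hG.and hC)).and <|
    (realizes_sameHits (A := fun m γ w => CurrentAt m (k m γ) w ∧ ¬ InSnd m (f m γ) w)
      (B := fun m γ w => CurrentAt m (k m γ) w ∧ ¬ InSnd m (g m γ) w)
      (hC.and hF.not) (hC.and hG.not)).and <|
    ((realizes_allServedAt hk hf).iff (realizes_allServedAt hk hg)).and
      (.eq (realizes_sizeAt hf) (realizes_sizeAt hg))

omit hg hk in
theorem realizes_consistentAt : RealizesProp SizesLe fun m γ => ConsistentAt m (f m γ) := by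
  refine .allSize (P := fun m γ w => ∃ y < m 0, InSnd m (f m γ) y ∧ colorAt m y = colorAt m w ∧
    ∀ z < m 0, InSnd m (f m γ) z → distAt m w y ≤ distAt m w z) ?_
  have hf2 := SizesLe.weaken (SizesLe.weaken hf)
  refine .exSize (P := fun m (p : Γ × ℕ) y => InSnd m (f m p.1) y ∧ colorAt m y = colorAt m p.2 ∧
    ∀ z < m 0, InSnd m (f m p.1) z → distAt m p.2 y ≤ distAt m p.2 z) ?_
  refine (realizes_inSnd hf2 realizes_var0).and ((RealizesProp.eq (realizes_colorAt realizes_var0)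
    (realizes_colorAt realizes_var1)).and (.allSize (P := fun m (p : (Γ × ℕ) × ℕ) z => InSnd m (f m p.1.1) z →
      distAt m p.1.2 p.2 ≤ distAt m p.1.2 z) ?_))
  exact (realizes_inSnd (SizesLe.weaken hf2) realizes_var0).imp
    (.le (realizes_distAt realizes_var2 realizes_var1)
      (realizes_distAt realizes_var2 realizes_var0))

omit hg hk in
theorem realizes_bestAt : RealizesProp SizesLe fun m γ => BestAt m (f m γ) := by
  refine (realizes_consistentAt hf).and (.all realizes_rows (fun _ _ _ h => h.2)
    (P := fun m γ i => ConsistentAt m i → sizeAt m (f m γ) ≤ sizeAt m i) ?_)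
  exact (realizes_consistentAt (Γ := Γ × ℕ) realizes_var0).imp
    (.le (realizes_sizeAt (SizesLe.weaken hf)) (realizes_sizeAt realizes_var0))

omit hf hg hk

theorem realizes_bestIndex : RealizesExpr (Γ := Γ) SizesLe fun m _ => bestIndex m := by
  classical
  refine .sum realizes_rows (fun _ _ _ h => h.2)
    (f := fun m _ j => if ∃ i < m 1, i ≤ j ∧ BestAt m i then 0 else 1)
    (.ite ?_ (.const 0) (.const 1))
  refine RealizesProp.ex (Γ := Γ × ℕ) (V := SizesLe) realizes_rows (fun _ _ _ h => h.2)
    (P := fun m p i => i ≤ p.2 ∧ BestAt m i) ?_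
  exact RealizesProp.and (Γ := (Γ × ℕ) × ℕ) (V := SizesLe) (.le realizes_var0 realizes_var1)
    (realizes_bestAt realizes_var0)

/-- Copying overwrites cells `0` and `1`, so the source address and the length are first put into
local variables and the loop relies on them alone. -/
theorem realizes_writeBest : RealizesMem (Γ := Γ) SizesLe fun m _ => writeBest m := by
  have hloop : RealizesMem (Γ := (Γ × ℕ) × ℕ) (fun _ p L => p.2 ≤ L)
      fun m (p : (Γ × ℕ) × ℕ) => copyOut m p.1.2 p.2 := by
    refine .loop (W := fun _ _ _ => True)
      (F := fun m (p : (Γ × ℕ) × ℕ) v => Function.update m v (if m (p.1.2 + v) = 0 then 0 else 1))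
      .snd (.store .snd (.ite (.eq (.load (.add ?_ .snd)) (.const 0)) (.const 0) (.const 1)))
      (fun _ _ _ h => h) (fun _ _ _ _ _ _ => trivial)
    exact RealizesExpr.fst (f := fun _ (p : (Γ × ℕ) × ℕ) => p.1.2)
      (.fst (f := fun _ (p : Γ × ℕ) => p.2) .snd)
  refine .bind (G := fun m p => copyOut m p.2 (m 0)) (W := SizesLe)
    ((realizes_rowAddr realizes_bestIndex).add realizes_size) ?_ fun _ _ _ h => h
  exact .bind (G := fun m (p : (Γ × ℕ) × ℕ) => copyOut m p.1.2 p.2) realizes_size hloop SizesLe.size_le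

theorem foldUpTo_apply {F : (ℕ → ℕ) → ℕ → ℕ → ℕ} {x : ℕ} (hF : ∀ m i, F m i x = m x)
    (m : ℕ → ℕ) (N : ℕ) : foldUpTo F m N x = m x :=
  foldUpTo_induction (N := N) (fun _ m' => m' x = m x) rfl
    (fun i _ a ha => (hF a i).trans ha) N le_rfl

omit [RegContext Γ] in
theorem SizesLe.congr {Δ : Type} {m m' : ℕ → ℕ} {γ : Γ} {δ : Δ} {L : ℕ} (h : SizesLe m γ L)
    (h0 : m' 0 = m 0) (h1 : m' 1 = m 1) : SizesLe m' δ L := by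
  unfold SizesLe at *
  rwa [h0, h1]

theorem writeRow_apply (m : ℕ → ℕ) (t j : ℕ) {x : ℕ} (hx : x < 2) : writeRow m t j x = m x :=
  foldUpTo_apply (fun a i => Function.update_of_ne (by unfold rowAddr; omega) ..) _ _

theorem fillTable_apply (val : (ℕ → ℕ) → ℕ → ℕ → ℕ) (m : ℕ → ℕ) {x : ℕ} (hx : x < 2) :
    fillTable val m x = m x :=
  foldUpTo_apply (fun a i => foldUpTo_apply (fun b j =>
    Function.update_of_ne (by unfold distAddr; omega) ..) _ _) _ _

theorem realizes_writeRow :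
    RealizesMem (Γ := (Γ × ℕ) × ℕ) SizesLe fun m p => writeRow m p.1.2 p.2 := by
  refine .loop (W := SizesLe) (F := fun m (p : (Γ × ℕ) × ℕ) i =>
    Function.update m (rowAddr m (m 1) + i)
      (if keyAt m i = p.1.2 then 1 else m (rowAddr m p.2 + i)))
    (realizes_size.add realizes_size) (.store (.add (realizes_rowAddr realizes_rows) .snd)
      (.ite (.eq (realizes_keyAt .snd) realizes_var2) (.const 1)
        (.load (.add (realizes_rowAddr realizes_var1) .snd))))
    (fun _ _ _ h => h.1) fun m p L h i _ => h.congr ?_ ?_ <;>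
  exact foldUpTo_apply (fun a i => Function.update_of_ne (by unfold rowAddr; omega) ..) _ _

theorem realizes_keepRow : RealizesMem (Γ := (Γ × ℕ) × ℕ) SizesLe fun m p => keepRow m p.1.2 := by
  classical
  refine .ite ?_ .skip (.store (.const 1) (realizes_rows.add (.const 1)))
  exact .ex realizes_rows (fun _ _ _ h => h.2)
    (P := fun m (p : (Γ × ℕ) × ℕ) q => SameSignatureAt m (p.1.2 + 1 - m 0) q (m 1))
    (realizes_sameSignatureAt realizes_var0 realizes_rows
      ((realizes_var2.add (.const 1)).sub realizes_size))

theorem realizes_fillTable {val : (ℕ → ℕ) → Γ → ℕ → ℕ → ℕ}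
    (hval : RealizesExpr (Γ := (Γ × ℕ) × ℕ) SizesLe fun m p => val m p.1.1 p.1.2 p.2) :
    RealizesMem SizesLe fun m γ => fillTable (fun m => val m γ) m := by
  refine .loop (W := SizesLe) (F := fun m γ u => foldUpTo (fun m v =>
    Function.update m (distAddr m u v) (val m γ u v)) m (m 0)) realizes_size
    (.loop (W := SizesLe) (F := fun m (p : Γ × ℕ) v => Function.update m (distAddr m p.2 v)
      (val m p.1 p.2 v)) realizes_size (.store (realizes_distAddr realizes_var1 realizes_var0) hval)
      SizesLe.size_le fun m p L h i _ => h.congr ?_ ?_)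
    SizesLe.size_le fun m γ L h i _ => h.congr ?_ ?_
  · exact foldUpTo_apply (fun a i => Function.update_of_ne (by unfold distAddr; omega) ..) _ _
  · exact foldUpTo_apply (fun a i => Function.update_of_ne (by unfold distAddr; omega) ..) _ _
  · exact foldUpTo_apply (fun a i => foldUpTo_apply (fun b j =>
      Function.update_of_ne (by unfold distAddr; omega) ..) _ _) _ _
  · exact foldUpTo_apply (fun a i => foldUpTo_apply (fun b j =>
      Function.update_of_ne (by unfold distAddr; omega) ..) _ _) _ _

theorem realizes_bfs : RealizesMem (Γ := Γ) SizesLe fun m _ => bfs m := by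
  classical
  refine Realizes.congr (RealizesMem.seq (W := SizesLe)
    (F := fun m _ => fillTable (fun m u v => if u = v then 0 else m 0) m)
    (G := fun m _ => foldUpTo (fun m k => fillTable (bfsEntry k) m) m (m 0)) ?_ ?_
    (fun m γ L h => h.congr (fillTable_apply _ _ (by omega)) (fillTable_apply _ _ (by omega))))
    (fun m γ L _ => ?_) (fun _ _ _ _ => rfl)
  · exact realizes_fillTable (val := fun m _ u v => if u = v then 0 else m 0)
      (.ite (.eq realizes_var1 realizes_var0) (.const 0) realizes_size)
  · refine .loop (W := SizesLe) (F := fun m _ k => fillTable (bfsEntry k) m) realizes_size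
      (realizes_fillTable (val := fun m (p : Γ × ℕ) u v => bfsEntry p.2 m u v) ?_) SizesLe.size_le
      fun m γ L h i _ => h.congr ?_ ?_
    · refine .ite (.and (.eq (realizes_distAt realizes_var1 realizes_var0) realizes_size)
        (.exSize (P := fun m (p : ((Γ × ℕ) × ℕ) × ℕ) w =>
          distAt m p.1.2 w = p.1.1.2 ∧ adjAt m w p.2 ≠ 0) ?_))
        (realizes_var2.add (.const 1)) (realizes_distAt realizes_var1 realizes_var0)
      exact .and (.eq (realizes_distAt realizes_var2 realizes_var0)
        (SizesLe.weaken realizes_var2)) (.ne_zero (realizes_adjAt realizes_var0 realizes_var1))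
    · exact foldUpTo_apply (fun a i => fillTable_apply _ _ (by omega)) _ _
    · exact foldUpTo_apply (fun a i => fillTable_apply _ _ (by omega)) _ _
  · have h0 := fillTable_apply (fun m u v => if u = v then 0 else m 0) m (x := 0) (by omega)
    simp only [bfs, h0]

/-- The bound for the numbers of iterations of all loops. -/
def loopBound (r n : ℕ) : ℕ := n + n + 1 + (n + n) * signatureBound r n

/-- The memory satisfies the invariant of the search, and `L` bounds the numbers of iterations. -/
def SearchReady (t : ℕ) (m : ℕ → ℕ) (L : ℕ) : Prop :=
  ∃ (n c : ℕ) (G : SimpleGraph (Fin n)) (color : Fin n → Fin c), SearchInvariant G color t m ∧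
    t ≤ n + n ∧ loopBound (neighborhoodDiversity G) n ≤ L

omit [RegContext Γ] in
theorem SearchReady.sizesLe {t : ℕ} {m : ℕ → ℕ} {L : ℕ} (h : SearchReady t m L) {γ : Γ} :
    SizesLe m γ L := by
  obtain ⟨n, c, G, color, h, ht, hL⟩ := h
  have h1 := h.le
  have h2 := Nat.mul_le_mul_right (signatureBound (neighborhoodDiversity G) n) ht
  unfold loopBound at hL
  exact ⟨by rw [h.tables.size]; omega, by omega⟩

/-- The number of rows, hence the inner loop length, is bounded only through the search invariant,
so the precondition carries the graph and the invariant along. -/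
theorem realizes_search :
    RealizesMem (Γ := Γ) (fun m _ L => SearchReady 0 m L) fun m _ => search m := by
  refine .loop (W := fun m p L => SearchReady p.2 m L ∧ p.2 + 1 ≤ m 0 + m 0)
    (F := fun m _ t => searchRound m t) (realizes_size.add realizes_size) ?_
    (fun m γ L h => (h.sizesLe (γ := γ)).1) ?_
  · refine .loop (W := SizesLe) (F := fun m (p : Γ × ℕ) j => keepRow (writeRow m p.2 j) p.2)
      realizes_rows ?_ (fun m p L h => (h.1.sizesLe (γ := p)).2) ?_
    · exact .seq (F := fun m (p : (Γ × ℕ) × ℕ) => writeRow m p.1.2 p.2) (W := SizesLe)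
        (G := fun m (p : (Γ × ℕ) × ℕ) => keepRow m p.1.2) realizes_writeRow realizes_keepRow
        fun m p L h => h.congr (writeRow_apply _ _ _ (by omega)) (writeRow_apply _ _ _ (by omega))
    · rintro m p L ⟨⟨n, c, G, color, h, ht, hL⟩, hlt⟩ j hj
      have hr := h.roundInvariant j hj.le
      have h1 := hr.le_add
      -- After `t` completed rounds and part of the next there are at most `1 + (t + 1) *
      -- signatureBound` rows, within `loopBound` because `t + 1 ≤ n + n`.
      have h2 := h.le
      rw [h.tables.size] at hlt
      have h3 := Nat.mul_le_mul_right (signatureBound (neighborhoodDiversity G) n) hlt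
      rw [add_mul, one_mul] at h3
      unfold loopBound at hL
      exact ⟨by rw [hr.tables.size]; omega, by omega⟩
  · rintro m γ L ⟨n, c, G, color, h, ht, hL⟩ i hi
    have hi' := h.search i hi.le
    rw [h.tables.size] at hi
    exact ⟨⟨n, c, G, color, hi', hi.le, hL⟩, by rw [hi'.tables.size]; omega⟩

/-- The memory holds an input, and `L` bounds the numbers of iterations. -/
def InputReady (m : ℕ → ℕ) (L : ℕ) : Prop :=
  ∃ (n c : ℕ) (G : SimpleGraph (Fin n)) (color : Fin n → Fin c), HoldsInput G color m ∧
    (∀ x, 2 + n + n * n ≤ x → m x = 0) ∧ loopBound (neighborhoodDiversity G) n ≤ L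

theorem HoldsInput.searchInvariant {n c : ℕ} {G : SimpleGraph (Fin n)} {color : Fin n → Fin c}
    {m : ℕ → ℕ} (h : HoldsInput G color m) (hzero : ∀ x, 2 + n + n * n ≤ x → m x = 0) :
    SearchInvariant G color 0 (bfs (Function.update m 1 1)) :=
  searchInvariant_bfs (h.of_eq fun _ hx _ => Function.update_of_ne hx ..)
    (Function.update_self ..) fun x hx => by rw [Function.update_of_ne (by omega), hzero x hx]

theorem realizes_minConsistentSubset :
    RealizesMem (Γ := Unit) (fun m _ L => InputReady m L)
      fun m _ => writeBest (search (bfs (Function.update m 1 1))) := by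
  refine .seq (F := fun m _ => search (bfs (Function.update m 1 1))) (W := SizesLe)
    (G := fun m _ => writeBest m)
    (.seq (F := fun m _ => bfs (Function.update m 1 1)) (G := fun m _ => search m)
      (W := fun m _ L => SearchReady 0 m L)
      (.seq (F := fun m _ => Function.update m 1 1) (G := fun m _ => bfs m) (W := SizesLe)
        (.store (.const 1) (.const 1)) realizes_bfs ?_) realizes_search ?_) realizes_writeBest ?_
  · rintro m γ L ⟨n, c, G, color, h, hz, hL⟩
    unfold loopBound at hL
    refine ⟨?_, by rw [Function.update_self]; omega⟩
    rw [Function.update_of_ne (by omega), h.size]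
    omega
  · rintro m γ L ⟨n, c, G, color, h, hz, hL⟩
    exact ⟨n, c, G, color, h.searchInvariant hz, by omega, hL⟩
  · rintro m γ L ⟨n, c, G, color, h, hz, hL⟩
    have h1 := h.searchInvariant hz
    have h2 := h1.search _ le_rfl
    exact SearchReady.sizesLe (t := n + n)
      ⟨n, c, G, color, by rw [h1.tables.size] at h2; rw [search, h1.tables.size]; exact h2, le_rfl, hL⟩

end Programs

/-! ### The running time and the main theorem. -/

theorem succ_loopBound_le (r n : ℕ) : loopBound r n + 1 ≤ 2 ^ (4 * r + 3) * (n + 1) ^ 2 := by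
  have h : 1 ≤ 2 ^ (4 * r + 1) := Nat.one_le_two_pow
  unfold loopBound signatureBound
  rw [show 2 ^ (4 * r + 3) = 4 * 2 ^ (4 * r + 1) by ring]
  nlinarith [Nat.zero_le (n * n), Nat.mul_le_mul_right n h, Nat.mul_le_mul_right (n * n) h]

theorem primrec_two_pow : Primrec fun r : ℕ => 2 ^ r := by
  refine (Primrec.nat_rec₁ (f := fun _ x => 2 * x) 1
    (Primrec.nat_mul.comp (Primrec.const 2) Primrec.snd)).of_eq fun r => ?_
  induction r with
  | zero => rfl
  | succ r ih => rw [pow_succ, ← ih, mul_comm]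

/-- For `r ≥ 2` the base `2` is at most `r`; the constant `c * 2 ^ e` covers `r = 1`, and `r = 0`
uses `0 ^ 0 = 1`. -/
theorem two_pow_le (c e r : ℕ) : c * 2 ^ (e * r) ≤ (c * 2 ^ e + e) * r ^ ((c * 2 ^ e + e) * r) := by
  rcases r with _ | _ | r
  · have := Nat.mul_le_mul_left c (Nat.one_le_two_pow (n := e))
    simp only [mul_zero, pow_zero, mul_one] at this ⊢
    omega
  · simp
  · refine Nat.mul_le_mul ?_ ?_
    · have := Nat.mul_le_mul_left c (Nat.one_le_two_pow (n := e))
      omega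
    · exact (Nat.pow_le_pow_left (by omega) _).trans
        (Nat.pow_le_pow_right (by omega) (Nat.mul_le_mul_right _ (by omega)))

theorem mainTheorem2 :
    ∃ (p : RamProg) (f : ℕ → ℕ) (d : ℕ),
      Computable f ∧
      (∃ C : ℕ, ∀ r : ℕ, f r ≤ C * r ^ (C * r)) ∧
      SolvesMCSInTime p (fun {n} G => f (neighborhoodDiversity G) * (n + 1) ^ d) := by
  obtain ⟨p, T, ⟨c, e, hT⟩, hp⟩ := realizes_minConsistentSubset
  -- The factors come from `c * (L + 1) ^ e` with `L + 1 ≤ 2 ^ (4 * r + 3) * (n + 1) ^ 2`.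
  refine ⟨p 0, fun r => c * 2 ^ (3 * e) * 2 ^ (4 * e * r), 2 * e, ?_,
    ⟨_, two_pow_le _ _⟩, fun n k G color => ?_⟩
  · exact (Primrec.nat_mul.comp (Primrec.const _)
      (primrec_two_pow.comp (Primrec.nat_mul.comp (Primrec.const _) Primrec.id))).to_comp
  · obtain ⟨hin, hz⟩ := holdsInput_init G color
    obtain ⟨s, t, hex, ht, hm, -, -⟩ := hp 0 le_rfl (RamState.init (encodeColoredGraph G color)) ()
      (loopBound (neighborhoodDiversity G) n) ⟨n, k, G, color, hin, hz, le_rfl⟩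
      (fun i hi => absurd hi (by simp [size]))
    refine ⟨s, t, hex, ht.trans ((hT _).trans ?_), ?_⟩
    · calc c * (loopBound (neighborhoodDiversity G) n + 1) ^ e
          ≤ c * (2 ^ (4 * neighborhoodDiversity G + 3) * (n + 1) ^ 2) ^ e :=
            Nat.mul_le_mul_left _ (Nat.pow_le_pow_left (succ_loopBound_le _ _) _)
        _ = c * 2 ^ (3 * e) * 2 ^ (4 * e * neighborhoodDiversity G) * (n + 1) ^ (2 * e) := by
            rw [mul_pow, ← pow_mul, ← pow_mul, add_mul, pow_add]
            ring
    · have h1 := hin.searchInvariant hz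
      have h2 := h1.search _ le_rfl
      rw [h1.tables.size] at h2
      have h3 : SearchInvariant G color (n + n) (search (bfs (Function.update
          (RamState.init (encodeColoredGraph G color)).mem 1 1))) := by
        rw [search, h1.tables.size]
        exact h2
      rw [hm]
      exact h3.writeBest_spec
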